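/- Let $p\ge 2$ and let $G\sim N(0,1)$ be a standard Gaussian random variable. Write $\|Y\|_p=(\mathbb E|Y|^p)^{1/p}$. For every $n\ge 1$, all independent standard exponential random variables $E_1,\dots,E_n$ (density $e^{-t}\mathbf 1_{[0,\infty)}(t)$) and all real numbers $x_1,\dots,x_n$, the random variable $X=\sum_{j=1}^n x_jE_j$ has a finite $p$-th absolute moment and satisfies $$\|X\|_p\ \ge\ \|G\|_p\,\sqrt{\operatorname{Var}(X)}.$$ Moreover, the constant $\|G\|_p$ is asymptotically sharp: if $E_1,E_2,\dots$ are independent standard exponential random variables and $X_m=\frac1{\sqrt{2m}}\sum_{j=1}^{2m}(-1)^{j-1}E_j$, then $\operatorname{Var}(X_m)=1$ for every $m\ge1$, and $\|X_m\|_p\to\|G\|_p$ as $m\to\infty$. -/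

import Mathlib

open MeasureTheory ProbabilityTheory Filter Topology

/-!
Let `p > 2`. The inequality is proved for the larger family `X = a + s * G + ∑ j, x j * E j`, with
a drift `a` and an independent Gaussian component, in the form
`E |X| ^ p ≥ E |G| ^ p * (s ^ 2 + ∑ j, x j ^ 2) ^ (p / 2)`. For fixed variance `1` the `p`-th moment
has a minimiser (`exists_absMoment_le`), and it suffices to show that a minimiser has no exponential
part: then it is a Gaussian variable with drift, and drifts do not help
(`integral_abs_rpow_gaussianReal_le`).

Put `q = p - 2`, `u t = E |X + t| ^ q` at a minimiser `X`, and let `m` be the minimum. The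
stationarity conditions are `E (X * |X| ^ q) = 0` and, after an integration by parts,
`m = (p - 1) * E (E j * |X| ^ q)` whenever `x j ≠ 0`. Since moving variance to the Gaussian
component does not help either, `m ≤ (p - 1) * u 0` (`le_integral_abs_rpow_of_min`), so
`E (E j * |X| ^ q) ≤ u 0` for these `j`. Three facts are then combined in
`coeff_some_eq_zero_of_min`.

* Averaging over Gaussian and exponential variables preserves functions with a single sign change,
  as their densities are log-concave. Hence the increments of `u` change sign once, `u` is strictly
  monotone on both sides of its minimum, and, after replacing `X` by `-X` if necessary, `u t > u 0`
  for all `t < 0` (`integral_abs_rpow_affineForm_lt`).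
* Weighting by `E j` adds an independent copy of `x j * E j` to `X`, so `x j < 0` would give
  `E (E j * |X| ^ q) > u 0`. All `x j` are therefore nonnegative. The same monotonicity gives
  `s * E (G * |X| ^ q) ≤ 0`, a derivative of `u` at `0` from the left.
* If `x j ≥ 0` for all `j`, and not all vanish, then `Y = s * G + ∑ j, x j * (E j - 1)` satisfies
  `E (Y * |Y| ^ q) > 0` (`integral_mul_abs_rpow_affineForm_pos`). For `q < 2` this follows from a
  Fourier representation of the signed power and the positivity of an oscillating integral; larger
  `q` are reduced to this range by integration by parts. In view of `E (X * |X| ^ q) = 0`, the mean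
  of `X` is negative.

If some `x j` were nonzero, all terms of
`0 = E (X * |X| ^ q) = (E X) * u 0 + s * E (G * |X| ^ q) + ∑ j, x j * E ((E j - 1) * |X| ^ q)`
would be nonpositive and the first one negative, a contradiction.

Sharpness: by characteristic functions, the balanced combination of `2 * m` exponential variables
is distributed as `√(S / m) * G`, with `S` an independent sum of `m` standard exponential variables
(`map_balanced_eq_mixture`). Its `p`-norm is `‖G‖_p * √(‖S / m‖_(p/2))`. The law of large
numbers in `L ^ (p / 2)` bounds this from above by a sequence tending to `‖G‖_p`, and the moment
inequality bounds it from below by `‖G‖_p`.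
-/

/-! ### Continuous functions of polynomial growth -/

section PolyGrowth

variable {V W U : Type*} [NormedAddCommGroup V] [NormedAddCommGroup W] [NormedAddCommGroup U]

/-- Continuous maps bounded by a power of `1 + ‖v‖`. They are
integrable against every measure with finite moments. -/
@[fun_prop]
def PolyGrowth (F : V → W) : Prop :=
  Continuous F ∧ ∃ C : ℝ, ∃ k : ℕ, 0 ≤ C ∧ ∀ v, ‖F v‖ ≤ C * (1 + ‖v‖) ^ k

lemma PolyGrowth.continuous {F : V → W} (h : PolyGrowth F) : Continuous F := h.1

lemma PolyGrowth.of_bound {F : V → W} (hF : Continuous F) (C : ℝ)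
    (h : ∀ v, ‖F v‖ ≤ C * (1 + ‖v‖)) : PolyGrowth F := by
  refine ⟨hF, C, 1, ?_, fun v => by simpa using h v⟩
  have := (norm_nonneg _).trans (h 0)
  simpa using this

@[fun_prop]
lemma PolyGrowth.id : PolyGrowth (fun v : V => v) :=
  .of_bound continuous_id 1 fun v => by simp

@[fun_prop]
lemma PolyGrowth.const (w : W) : PolyGrowth (fun _ : V => w) :=
  .of_bound continuous_const ‖w‖ fun v =>
    le_mul_of_one_le_right (norm_nonneg _) (by linarith [norm_nonneg v])

@[fun_prop]
lemma PolyGrowth.comp {F : W → U} {X : V → W} (hF : PolyGrowth F) (hX : PolyGrowth X) :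
    PolyGrowth (fun v => F (X v)) := by
  obtain ⟨hF, C, k, hC, h⟩ := hF
  obtain ⟨hX, C', k', hC', h'⟩ := hX
  refine ⟨hF.comp hX, C * (1 + C') ^ k, k' * k, by positivity, fun v => (h _).trans ?_⟩
  rw [mul_assoc, pow_mul, ← mul_pow]
  have : (1 : ℝ) ≤ (1 + ‖v‖) ^ k' := one_le_pow₀ (by linarith [norm_nonneg v])
  gcongr
  nlinarith [h' v]

@[fun_prop]
lemma PolyGrowth.prodMk {F : V → W} {G : V → U} (hF : PolyGrowth F) (hG : PolyGrowth G) :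
    PolyGrowth (fun v => (F v, G v)) := by
  obtain ⟨hF, C, k, hC, h⟩ := hF
  obtain ⟨hG, C', k', hC', h'⟩ := hG
  refine ⟨hF.prodMk hG, C + C', k + k', by positivity, fun v => ?_⟩
  have h1 : (1 : ℝ) ≤ 1 + ‖v‖ := by linarith [norm_nonneg v]
  have e1 : (1 + ‖v‖) ^ k ≤ (1 + ‖v‖) ^ (k + k') := pow_le_pow_right₀ h1 (by omega)
  have e2 : (1 + ‖v‖) ^ k' ≤ (1 + ‖v‖) ^ (k + k') := pow_le_pow_right₀ h1 (by omega)
  have e0 : 0 ≤ (1 + ‖v‖) ^ (k + k') := by positivity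
  rw [Prod.norm_mk, max_le_iff]
  constructor
  · nlinarith [h v, mul_le_mul_of_nonneg_left e1 hC, mul_nonneg hC' e0]
  · nlinarith [h' v, mul_le_mul_of_nonneg_left e2 hC', mul_nonneg hC e0]

@[fun_prop]
lemma PolyGrowth.fst : PolyGrowth (Prod.fst : V × W → V) :=
  .of_bound continuous_fst 1 fun v => by linarith [norm_fst_le v]

@[fun_prop]
lemma PolyGrowth.snd : PolyGrowth (Prod.snd : V × W → W) :=
  .of_bound continuous_snd 1 fun v => by linarith [norm_snd_le v]

@[fun_prop]
lemma PolyGrowth.fst' {F : V → W × U} (hF : PolyGrowth F) : PolyGrowth (fun v => (F v).1) :=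
  PolyGrowth.fst.comp hF

@[fun_prop]
lemma PolyGrowth.snd' {F : V → W × U} (hF : PolyGrowth F) : PolyGrowth (fun v => (F v).2) :=
  PolyGrowth.snd.comp hF

@[fun_prop]
lemma PolyGrowth.pi_apply {ι : Type*} [Fintype ι] (i : ι) :
    PolyGrowth (fun ω : ι → W => ω i) :=
  .of_bound (continuous_apply i) 1 fun v => by linarith [norm_le_pi_norm v i]

@[fun_prop]
lemma PolyGrowth.add {F G : V → W} (hF : PolyGrowth F) (hG : PolyGrowth G) :
    PolyGrowth (fun v => F v + G v) := by
  have : PolyGrowth (fun x : W × W => x.1 + x.2) :=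
    .of_bound (by fun_prop) 2 fun v => by
      linarith [norm_add_le v.1 v.2, norm_fst_le v, norm_snd_le v]
  exact this.comp (hF.prodMk hG)

@[fun_prop]
lemma PolyGrowth.neg {F : V → W} (hF : PolyGrowth F) : PolyGrowth (fun v => - F v) := by
  obtain ⟨hF, C, k, hC, h⟩ := hF
  exact ⟨hF.neg, C, k, hC, by simpa using h⟩

@[fun_prop]
lemma PolyGrowth.sub {F G : V → W} (hF : PolyGrowth F) (hG : PolyGrowth G) :
    PolyGrowth (fun v => F v - G v) := by
  simpa only [sub_eq_add_neg] using hF.add hG.neg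

@[fun_prop]
lemma PolyGrowth.mul {F G : V → ℝ} (hF : PolyGrowth F) (hG : PolyGrowth G) :
    PolyGrowth (fun v => F v * G v) := by
  obtain ⟨hF, C, k, hC, h⟩ := hF
  obtain ⟨hG, C', k', hC', h'⟩ := hG
  refine ⟨hF.mul hG, C * C', k + k', by positivity, fun v => ?_⟩
  rw [norm_mul, pow_add, mul_mul_mul_comm]
  gcongr
  exacts [h v, h' v]

@[fun_prop]
lemma PolyGrowth.pow {F : V → ℝ} (hF : PolyGrowth F) (k : ℕ) :
    PolyGrowth (fun v => F v ^ k) := by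
  induction k with
  | zero => simpa using PolyGrowth.const (V := V) (1 : ℝ)
  | succ k ih => simpa only [pow_succ] using ih.mul hF

@[fun_prop]
lemma PolyGrowth.sum {ι : Type*} {F : ι → V → W} (s : Finset ι) (hF : ∀ i, PolyGrowth (F i)) :
    PolyGrowth (fun v => ∑ i ∈ s, F i v) := by
  classical
  induction s using Finset.induction_on with
  | empty => simpa using PolyGrowth.const (V := V) (0 : W)
  | insert i s hi ih => simpa only [Finset.sum_insert hi] using (hF i).add ih

@[fun_prop]
lemma PolyGrowth.norm {F : V → W} (hF : PolyGrowth F) : PolyGrowth (fun v => ‖F v‖) := by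
  obtain ⟨hF, C, k, hC, h⟩ := hF
  exact ⟨hF.norm, C, k, hC, by simpa using h⟩

@[fun_prop]
lemma PolyGrowth.abs {F : V → ℝ} (hF : PolyGrowth F) : PolyGrowth (fun v => |F v|) := hF.norm

lemma PolyGrowth.abs_rpow {F : V → ℝ} (hF : PolyGrowth F) {r : ℝ} (hr : 0 ≤ r) :
    PolyGrowth (fun v => |F v| ^ r) := by
  have : PolyGrowth (fun t : ℝ => |t| ^ r) := by
    refine ⟨by fun_prop (disch := simp [hr]), 1, ⌈r⌉₊, zero_le_one, fun t => ?_⟩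
    rw [one_mul, Real.norm_of_nonneg (by positivity), Real.norm_eq_abs, ← Real.rpow_natCast]
    calc |t| ^ r ≤ (1 + |t|) ^ r := by gcongr; linarith
      _ ≤ _ := Real.rpow_le_rpow_of_exponent_le (by linarith [abs_nonneg t]) (Nat.le_ceil r)
  exact this.comp hF

@[fun_prop]
lemma PolyGrowth.update {ι : Type*} [Fintype ι] [DecidableEq ι] (i : ι) :
    PolyGrowth (fun x : (ι → ℝ) × ℝ => Function.update x.1 i x.2) := by
  refine .of_bound (by fun_prop) 1 fun x => ?_
  rw [one_mul, pi_norm_le_iff_of_nonneg (by positivity)]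
  intro j
  by_cases h : j = i
  · subst h; simpa using (norm_snd_le x).trans (by linarith)
  · simpa [h] using ((norm_le_pi_norm x.1 j).trans (norm_fst_le x)).trans (by linarith)

/-- All absolute moments are finite. -/
def HasAllMoments [MeasurableSpace V] (μ : Measure V) : Prop :=
  ∀ k : ℕ, Integrable (fun v => ‖v‖ ^ k) μ

lemma HasAllMoments.integrable_one_add [MeasurableSpace V] [BorelSpace V]
    {μ : Measure V} (hμ : HasAllMoments μ) (R : ℝ) (k : ℕ) :
    Integrable (fun v => (R + ‖v‖) ^ k) μ := by
  simp only [add_pow]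
  refine integrable_finsetSum _ fun i _ => ?_
  exact ((hμ (k - i)).const_mul _).mul_const _

variable [MeasurableSpace V] [BorelSpace V]

lemma PolyGrowth.integrable {F : V → ℝ} (hF : PolyGrowth F) {μ : Measure V}
    (hμ : HasAllMoments μ) : Integrable F μ := by
  obtain ⟨hF, C, k, hC, h⟩ := hF
  exact ((hμ.integrable_one_add 1 k).const_mul C).mono' hF.aestronglyMeasurable
    (Eventually.of_forall h)

/-- Averaging over some of the variables preserves polynomial growth. -/
lemma PolyGrowth.integral_right {F : U × V → ℝ} (hF : PolyGrowth F) {μ : Measure V}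
    (hμ : HasAllMoments μ) : PolyGrowth (fun u => ∫ v, F (u, v) ∂μ) := by
  have hF' := hF
  obtain ⟨hF, C, k, hC, h⟩ := hF
  have hb : ∀ u v, ‖F (u, v)‖ ≤ C * ((1 + ‖u‖) + ‖v‖) ^ k := fun u v => by
    refine (h _).trans (mul_le_mul_of_nonneg_left (pow_le_pow_left₀ (by positivity) ?_ k) hC)
    have : ‖(u, v)‖ ≤ ‖u‖ + ‖v‖ := by
      rw [Prod.norm_mk]; exact max_le (by linarith [norm_nonneg v]) (by linarith [norm_nonneg u])
    linarith
  refine ⟨?_, C * ∫ v, (1 + ‖v‖) ^ k ∂μ, k, ?_, fun u => ?_⟩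
  · rw [continuous_iff_continuousAt]
    intro u₀
    refine continuousAt_of_dominated (bound := fun v => C * ((1 + (‖u₀‖ + 1)) + ‖v‖) ^ k)
      (Eventually.of_forall fun u => by
        exact (hF.comp (by fun_prop : Continuous fun v : V => (u, v))).aestronglyMeasurable)
      ?_ ((hμ.integrable_one_add _ k).const_mul C)
      (Eventually.of_forall fun v => by fun_prop)
    have : ∀ᶠ u in 𝓝 u₀, ‖u‖ < ‖u₀‖ + 1 :=
      (continuous_norm.tendsto u₀).eventually_lt_const (by linarith)
    filter_upwards [this] with u hu
    refine Eventually.of_forall fun v => (hb u v).trans ?_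
    gcongr
  · exact mul_nonneg hC (integral_nonneg fun v => by positivity)
  · calc ‖∫ v, F (u, v) ∂μ‖ ≤ ∫ v, C * ((1 + ‖v‖) ^ k * (1 + ‖u‖) ^ k) ∂μ := by
          refine norm_integral_le_of_norm_le
            (((hμ.integrable_one_add 1 k).mul_const _).const_mul C)
            (Eventually.of_forall fun v => (hb u v).trans ?_)
          rw [← mul_pow]
          gcongr
          nlinarith [norm_nonneg u, norm_nonneg v, mul_nonneg (norm_nonneg u) (norm_nonneg v)]
      _ = _ := by rw [integral_const_mul, integral_mul_const, mul_assoc]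

lemma HasAllMoments.prod [MeasurableSpace W] [BorelSpace W] {μ : Measure V}
    {ν : Measure W} [IsFiniteMeasure μ] [IsFiniteMeasure ν]
    [SecondCountableTopology V] [SecondCountableTopology W]
    (hμ : HasAllMoments μ) (hν : HasAllMoments ν) : HasAllMoments (μ.prod ν) := by
  intro k
  refine Integrable.mono' (g := fun x => ‖x.1‖ ^ k + ‖x.2‖ ^ k)
    (((hμ k).comp_fst ν).add ((hν k).comp_snd μ))
    (by fun_prop) (Eventually.of_forall fun x => ?_)
  rw [norm_pow, norm_norm, Prod.norm_def]
  rcases max_cases ‖x.1‖ ‖x.2‖ with h | h <;> rw [h.1]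
  · linarith [pow_nonneg (norm_nonneg x.2) k]
  · linarith [pow_nonneg (norm_nonneg x.1) k]

lemma HasAllMoments.pi {ι : Type*} [Fintype ι] {μ : ι → Measure ℝ}
    [∀ i, IsProbabilityMeasure (μ i)] (hμ : ∀ i, HasAllMoments (μ i)) :
    HasAllMoments (Measure.pi μ) := by
  intro k
  have hi : ∀ i, Integrable (fun ω : ι → ℝ => ‖ω i‖ ^ k) (Measure.pi μ) := fun i =>
    (measurePreserving_eval μ i).integrable_comp_of_integrable (hμ i k)
  refine Integrable.mono' (g := fun ω => 1 + ∑ i, ‖ω i‖ ^ k)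
    ((integrable_const 1).add (integrable_finsetSum _ fun i _ => hi i))
    (by fun_prop) (Eventually.of_forall fun ω => ?_)
  rw [norm_pow, norm_norm]
  have h0 : ∀ i, 0 ≤ ‖ω i‖ ^ k := fun i => by positivity
  rcases isEmpty_or_nonempty ι with h | h
  · rw [show ω = 0 from Subsingleton.elim _ _]
    rcases Nat.eq_zero_or_pos k with rfl | hk
    · simp
    · simp [zero_pow hk.ne']
  · obtain ⟨i, hi⟩ := Finite.exists_max fun i => ‖ω i‖
    have h1 : ‖ω‖ ≤ ‖ω i‖ := (pi_norm_le_iff_of_nonneg (norm_nonneg _)).2 hi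
    have h2 : ‖ω‖ ^ k ≤ ‖ω i‖ ^ k := by gcongr
    linarith [Finset.single_le_sum (fun i _ => h0 i) (Finset.mem_univ i)]

end PolyGrowth

/-- Resampling one coordinate of a product probability measure does not change the measure. -/
lemma measurePreserving_update {ι : Type*} [Fintype ι] [DecidableEq ι] (μ : ι → Measure ℝ)
    [∀ i, IsProbabilityMeasure (μ i)] (j : ι) :
    MeasurePreserving (fun x : (ι → ℝ) × ℝ => Function.update x.1 j x.2)
      ((Measure.pi μ).prod (μ j)) (Measure.pi μ) := by
  have hm : Measurable (fun x : (ι → ℝ) × ℝ => Function.update x.1 j x.2) := by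
    fun_prop
  refine ⟨hm, (Measure.pi_eq fun s hs => ?_).symm⟩
  rw [Measure.map_apply hm (MeasurableSet.univ_pi hs)]
  have : (fun x : (ι → ℝ) × ℝ => Function.update x.1 j x.2) ⁻¹' (Set.univ.pi s) =
      (Set.univ.pi (Function.update s j Set.univ)) ×ˢ (s j) := by
    ext ⟨ω, y⟩
    simp only [Set.mem_preimage, Set.mem_pi, Set.mem_univ, true_imp_iff, Set.mem_prod]
    constructor
    · intro h
      refine ⟨fun i => ?_, by simpa using h j⟩
      by_cases hi : i = j
      · subst hi; simp
      · simpa [hi] using h i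
    · rintro ⟨h, hy⟩ i
      by_cases hi : i = j
      · subst hi; simpa
      · simpa [hi] using h i
  rw [this, Measure.prod_prod, Measure.pi_pi, ← Finset.mul_prod_erase _ _ (Finset.mem_univ j),
    ← Finset.mul_prod_erase Finset.univ (fun i => μ i (s i)) (Finset.mem_univ j)]
  simp only [Function.update_self, measure_univ, one_mul]
  rw [mul_comm]
  congr 1
  exact Finset.prod_congr rfl fun i hi => by simp [Finset.ne_of_mem_erase hi]

lemma integral_update {ι : Type*} [Fintype ι] [DecidableEq ι] {μ : ι → Measure ℝ}
    [∀ i, IsProbabilityMeasure (μ i)] (hμ : ∀ i, HasAllMoments (μ i)) (j : ι)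
    {F : (ι → ℝ) → ℝ} (hF : PolyGrowth F) :
    ∫ ω, F ω ∂(Measure.pi μ) = ∫ ω, ∫ y, F (Function.update ω j y) ∂(μ j) ∂(Measure.pi μ) := by
  have hmp := measurePreserving_update μ j
  rw [← hmp.map_eq, integral_map hmp.measurable.aemeasurable
    hF.continuous.aestronglyMeasurable, hmp.map_eq, integral_prod]
  exact (hF.comp (PolyGrowth.update j)).integrable ((HasAllMoments.pi hμ).prod (hμ j))

/-! ### Differentiation under the integral -/

lemma hasDerivAt_integral_comp_add_mul {V : Type*} [NormedAddCommGroup V] [MeasurableSpace V]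
    [BorelSpace V] {μ : Measure V} (hμ : HasAllMoments μ) {F F' : ℝ → ℝ} (hF : PolyGrowth F)
    (hF' : PolyGrowth F') (hd : ∀ t, HasDerivAt F (F' t) t) {X K : V → ℝ} (hX : PolyGrowth X)
    (hK : PolyGrowth K) (ε₀ : ℝ) :
    HasDerivAt (fun ε => ∫ v, F (X v + ε * K v) ∂μ) (∫ v, K v * F' (X v + ε₀ * K v) ∂μ) ε₀ := by
  obtain ⟨C, k, hC, hb⟩ := hF'.2
  refine (hasDerivAt_integral_of_dominated_loc_of_deriv_le (Metric.ball_mem_nhds ε₀ one_pos)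
    (F := fun ε v => F (X v + ε * K v)) (F' := fun ε v => K v * F' (X v + ε * K v))
    (bound := fun v => |K v| * (C * (1 + (|X v| + (|ε₀| + 1) * |K v|)) ^ k))
    (Eventually.of_forall fun ε => ?_) ?_ ?_ (Eventually.of_forall fun v ε hε => ?_) ?_
    (Eventually.of_forall fun v ε hε => ?_)).2
  · have : PolyGrowth (fun v => F (X v + ε * K v)) := by fun_prop
    exact this.continuous.aestronglyMeasurable
  · exact PolyGrowth.integrable (by fun_prop) hμ
  · have : PolyGrowth (fun v => K v * F' (X v + ε₀ * K v)) := by fun_prop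
    exact this.continuous.aestronglyMeasurable
  · rw [norm_mul, Real.norm_eq_abs]
    refine mul_le_mul_of_nonneg_left ((hb _).trans ?_) (abs_nonneg _)
    have h1 : |ε| ≤ |ε₀| + 1 := by
      have : |ε - ε₀| < 1 := by simpa [Real.dist_eq] using hε
      linarith [abs_sub_abs_le_abs_sub ε ε₀]
    have h2 : |X v + ε * K v| ≤ |X v| + (|ε₀| + 1) * |K v| := by
      refine (abs_add_le _ _).trans ?_
      rw [abs_mul]
      gcongr
    gcongr
    exact h2
  · exact PolyGrowth.integrable (by fun_prop) hμ
  · have h1 : HasDerivAt (fun ε => X v + ε * K v) (K v) ε := by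
      simpa using ((hasDerivAt_id ε).mul_const (K v)).const_add (X v)
    rw [mul_comm]
    exact (hd _).comp ε h1

/-! ### The standard exponential law -/

instance : IsProbabilityMeasure (expMeasure 1) := isProbabilityMeasure_expMeasure one_pos

lemma expMeasure_one_eq : expMeasure 1 =
    (volume.restrict (Set.Ioi 0)).withDensity (fun y => ENNReal.ofReal (Real.exp (-y))) := by
  rw [← withDensity_indicator measurableSet_Ioi, expMeasure, gammaMeasure]
  refine withDensity_congr_ae ?_
  have : ∀ᵐ y : ℝ, y ≠ 0 := by simp [ae_iff]
  filter_upwards [this] with y hy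
  rcases lt_or_gt_of_ne hy with h | h
  · rw [gammaPDF_of_neg h, Set.indicator_of_notMem (by simpa using h.le)]
  · rw [gammaPDF_of_nonneg h.le, Set.indicator_of_mem (by simpa using h)]
    simp

lemma integral_expMeasure_one {E : Type*} [NormedAddCommGroup E] [NormedSpace ℝ E] (F : ℝ → E) :
    ∫ y, F y ∂(expMeasure 1) = ∫ y in Set.Ioi 0, Real.exp (-y) • F y := by
  rw [expMeasure_one_eq, integral_withDensity_eq_integral_toReal_smul (by fun_prop) (by simp)]
  simp [Real.exp_nonneg]

lemma integrable_expMeasure_one_iff {F : ℝ → ℝ} :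
    Integrable F (expMeasure 1) ↔ IntegrableOn (fun y => Real.exp (-y) * F y) (Set.Ioi 0) := by
  rw [expMeasure_one_eq, integrable_withDensity_iff_integrable_smul' (by fun_prop) (by simp)]
  simp [Real.exp_nonneg, IntegrableOn]

lemma ae_pos_expMeasure_one : ∀ᵐ y ∂(expMeasure 1), 0 < y := by
  rw [expMeasure_one_eq]
  exact (withDensity_absolutelyContinuous _ _).ae_le (ae_restrict_mem measurableSet_Ioi)

lemma hasAllMoments_expMeasure : HasAllMoments (expMeasure 1) := by
  intro k
  rw [integrable_expMeasure_one_iff]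
  refine (Real.GammaIntegral_convergent (s := k + 1) (by positivity)).congr_fun
    (fun y hy => ?_) measurableSet_Ioi
  simp [abs_of_pos (Set.mem_Ioi.1 hy)]

lemma PolyGrowth.tendsto_exp_neg_mul {F : ℝ → ℝ} (hF : PolyGrowth F) :
    Tendsto (fun y => Real.exp (-y) * F y) atTop (𝓝 0) := by
  obtain ⟨-, C, k, hC, h⟩ := hF
  have h1 : Tendsto (fun y : ℝ => Real.exp 1 * C * ((1 + y) ^ k * Real.exp (-(1 + y))))
      atTop (𝓝 0) := by
    simpa using ((Real.tendsto_pow_mul_exp_neg_atTop_nhds_zero k).comp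
      (tendsto_atTop_add_const_left _ (1 : ℝ) tendsto_id)).const_mul (Real.exp 1 * C)
  refine squeeze_zero_norm' ?_ h1
  filter_upwards [eventually_ge_atTop 0] with y hy
  have h2 := h y
  rw [Real.norm_eq_abs y, abs_of_nonneg hy] at h2
  rw [norm_mul, Real.norm_eq_abs (Real.exp _), abs_of_pos (Real.exp_pos _),
    show -(1 + y) = -1 + -y by ring, Real.exp_add]
  have h3 : Real.exp 1 * Real.exp (-1) = 1 := by rw [← Real.exp_add]; simp
  calc Real.exp (-y) * ‖F y‖ ≤ Real.exp (-y) * (C * (1 + y) ^ k) := by gcongr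
    _ = (Real.exp 1 * Real.exp (-1)) * (Real.exp (-y) * (C * (1 + y) ^ k)) := by rw [h3, one_mul]
    _ = _ := by ring

/-- Integration by parts against the standard exponential law. -/
lemma integral_sub_one_mul_expMeasure {F F' : ℝ → ℝ} (hF : PolyGrowth F) (hF' : PolyGrowth F')
    (hd : ∀ t, HasDerivAt F (F' t) t) :
    ∫ y, (y - 1) * F y ∂(expMeasure 1) = ∫ y, y * F' y ∂(expMeasure 1) := by
  have h1 : PolyGrowth (fun y : ℝ => (y - 1) * F y) := by fun_prop
  have h2 : PolyGrowth (fun y : ℝ => y * F' y) := by fun_prop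
  rw [← sub_eq_zero, ← integral_sub (h1.integrable hasAllMoments_expMeasure)
    (h2.integrable hasAllMoments_expMeasure), integral_expMeasure_one]
  have h3 : PolyGrowth (fun y : ℝ => -(y * F y)) := by fun_prop
  have := integral_Ioi_of_hasDerivAt_of_tendsto' (a := 0) (m := 0)
    (f := fun y => Real.exp (-y) * -(y * F y))
    (f' := fun y => Real.exp (-y) • ((y - 1) * F y - y * F' y)) (fun y _ => ?_)
    (integrable_expMeasure_one_iff.1 ((h1.sub h2).integrable hasAllMoments_expMeasure))
    h3.tendsto_exp_neg_mul
  · simpa using this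
  · have e1 : HasDerivAt (fun y => Real.exp (-y)) (-Real.exp (-y)) y := by
      simpa using (hasDerivAt_neg y).exp
    have e2 : HasDerivAt (fun y => Real.exp (-y) * -(y * F y)) _ y :=
      e1.mul (((hasDerivAt_id' y).mul (hd y)).neg)
    refine e2.congr_deriv ?_
    simp only [smul_eq_mul]; ring

lemma integral_comp_const_add_expMeasure (φ : ℝ → ℝ) (t : ℝ) :
    Real.exp (-t) * ∫ y, φ (t + y) ∂(expMeasure 1) =
      ∫ w in Set.Ioi t, Real.exp (-w) * φ w := by
  rw [integral_expMeasure_one, ← integral_const_mul]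
  have := (measurePreserving_add_left volume t).setIntegral_preimage_emb
    (measurableEmbedding_addLeft t) (fun w => Real.exp (-w) * φ w) (Set.Ioi t)
  rw [← this, Set.preimage_const_add_Ioi, sub_self]
  congr 1
  ext y
  rw [smul_eq_mul, neg_add, Real.exp_add]; ring

lemma integrableOn_exp_neg_mul {φ : ℝ → ℝ} (hφ : PolyGrowth φ) (t : ℝ) :
    IntegrableOn (fun w => Real.exp (-w) * φ w) (Set.Ioi t) := by
  have h0 : IntegrableOn (fun w => Real.exp (-w) * φ w) (Set.Ioi 0) :=
    integrable_expMeasure_one_iff.1 (hφ.integrable hasAllMoments_expMeasure)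
  have hc : Continuous fun w => Real.exp (-w) * φ w := by
    have := hφ.continuous
    fun_prop
  have h1 : IntegrableOn (fun w => Real.exp (-w) * φ w) (Set.Icc t 0) :=
    hc.continuousOn.integrableOn_Icc
  refine (h1.union h0).mono_set fun w hw => ?_
  rcases le_or_gt w 0 with h | h
  · exact Or.inl ⟨(Set.mem_Ioi.1 hw).le, h⟩
  · exact Or.inr h

lemma exp_neg_mul_integral_sub {φ : ℝ → ℝ} (hφ : PolyGrowth φ) (t t' : ℝ) :
    Real.exp (-t) * ∫ y, φ (t + y) ∂(expMeasure 1) -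
      Real.exp (-t') * ∫ y, φ (t' + y) ∂(expMeasure 1) = ∫ w in t..t', Real.exp (-w) * φ w := by
  rw [integral_comp_const_add_expMeasure, integral_comp_const_add_expMeasure,
    intervalIntegral.integral_Ioi_sub_Ioi' (integrableOn_exp_neg_mul hφ t)
      (integrableOn_exp_neg_mul hφ t')]

/-- Size biasing: the standard exponential law weighted by `y` is its convolution square. -/
lemma integral_mul_expMeasure {φ : ℝ → ℝ} (hφ : PolyGrowth φ) :
    ∫ y, y * φ y ∂(expMeasure 1) = ∫ t, ∫ y, φ (t + y) ∂(expMeasure 1) ∂(expMeasure 1) := by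
  have hΦ : PolyGrowth (fun t => ∫ y, φ (t + y) ∂(expMeasure 1)) :=
    PolyGrowth.integral_right (F := fun x : ℝ × ℝ => φ (x.1 + x.2)) (by fun_prop)
      hasAllMoments_expMeasure
  set Φ : ℝ → ℝ := fun t => ∫ y, φ (t + y) ∂(expMeasure 1) with hΦdef
  have h2 : PolyGrowth (fun y : ℝ => y * φ y) := by fun_prop
  rw [eq_comm, ← sub_eq_zero, ← integral_sub (hΦ.integrable hasAllMoments_expMeasure)
    (h2.integrable hasAllMoments_expMeasure), integral_expMeasure_one]
  have hc : Continuous fun w => Real.exp (-w) * φ w := by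
    have := hφ.continuous
    fun_prop
  have hder : ∀ t, HasDerivAt (fun t => Real.exp (-t) * Φ t) (-(Real.exp (-t) * φ t)) t := by
    intro t
    have e : (fun t => Real.exp (-t) * Φ t) = fun t =>
        Real.exp (-0) * Φ 0 - ∫ w in (0:ℝ)..t, Real.exp (-w) * φ w := by
      ext t
      rw [← exp_neg_mul_integral_sub hφ 0 t]; ring
    rw [e]
    exact (intervalIntegral.integral_hasDerivAt_right (hc.intervalIntegrable _ _)
      (hc.stronglyMeasurableAtFilter _ _) hc.continuousAt).const_sub _
  have h3 : PolyGrowth (fun y : ℝ => y * Φ y) := by fun_prop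
  have := integral_Ioi_of_hasDerivAt_of_tendsto' (a := 0) (m := 0)
    (f := fun y => Real.exp (-y) * (y * Φ y))
    (f' := fun y => Real.exp (-y) • (Φ y - y * φ y)) (fun y _ => ?_)
    (integrable_expMeasure_one_iff.1 ((hΦ.sub h2).integrable hasAllMoments_expMeasure))
    h3.tendsto_exp_neg_mul
  · simpa using this
  · have e1 : HasDerivAt (fun y => y * (Real.exp (-y) * Φ y)) _ y :=
      (hasDerivAt_id' y).mul (hder y)
    have e2 : (fun y => Real.exp (-y) * (y * Φ y)) = fun y => y * (Real.exp (-y) * Φ y) := by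
      ext y; ring
    rw [e2]
    refine e1.congr_deriv ?_
    simp only [smul_eq_mul]; ring

/-! ### The standard Gaussian law -/

lemma hasAllMoments_gaussianReal : HasAllMoments (gaussianReal 0 1) := by
  intro k
  rcases Nat.eq_zero_or_pos k with rfl | hk
  · simp
  · simpa using (memLp_id_gaussianReal (μ := 0) (v := 1) k).integrable_norm_pow hk.ne'

lemma PolyGrowth.integrable_mul_exp_gaussianReal {F : ℝ → ℝ} (hF : PolyGrowth F) (τ : ℝ) :
    Integrable (fun y => F y * Real.exp (τ * y)) (gaussianReal 0 1) := by
  have h1 : MemLp F 2 (gaussianReal 0 1) := by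
    rw [memLp_two_iff_integrable_sq hF.continuous.aestronglyMeasurable]
    exact (hF.pow 2).integrable hasAllMoments_gaussianReal
  have h2 : MemLp (fun y => Real.exp (τ * y)) 2 (gaussianReal 0 1) := by
    rw [memLp_two_iff_integrable_sq (by fun_prop)]
    refine (integrable_exp_mul_gaussianReal (2 * τ)).congr (Eventually.of_forall fun y => ?_)
    simp only [← Real.exp_nat_mul]; congr 1; push_cast; ring
  exact h1.integrable_mul h2

lemma integral_comp_add_gaussianReal (φ : ℝ → ℝ) (τ : ℝ) :
    ∫ y, φ (y + τ) ∂(gaussianReal 0 1) =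
      Real.exp (-(τ ^ 2 / 2)) * ∫ y, φ y * Real.exp (τ * y) ∂(gaussianReal 0 1) := by
  rw [integral_gaussianReal_eq_integral_smul one_ne_zero,
    integral_gaussianReal_eq_integral_smul one_ne_zero, ← integral_const_mul,
    ← integral_sub_right_eq_self _ τ]
  congr 1
  ext y
  simp only [gaussianPDFReal_def, smul_eq_mul, sub_add_cancel]
  have : Real.exp (-(y - τ - 0) ^ 2 / (2 * (1 : NNReal))) =
      Real.exp (-(τ ^ 2 / 2)) * Real.exp (-(y - 0) ^ 2 / (2 * (1 : NNReal))) *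
        Real.exp (τ * y) := by
    rw [← Real.exp_add, ← Real.exp_add]; congr 1; push_cast; ring
  rw [this]; ring

/-- The derivative at `0` of Gaussian averages along translations; no smoothness of `φ` is
required, as the translation acts on the density. -/
lemma hasDerivAt_integral_comp_add_gaussianReal {φ : ℝ → ℝ} (hφ : PolyGrowth φ) :
    HasDerivAt (fun τ => ∫ y, φ (y + τ) ∂(gaussianReal 0 1))
      (∫ y, y * φ y ∂(gaussianReal 0 1)) 0 := by
  simp only [integral_comp_add_gaussianReal]
  have h1 : HasDerivAt (fun τ : ℝ => ∫ y, φ y * Real.exp (τ * y) ∂(gaussianReal 0 1))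
      (∫ y, φ y * (y * Real.exp (0 * y)) ∂(gaussianReal 0 1)) 0 := by
    have hφy : PolyGrowth (fun y => |φ y| * |y|) := by fun_prop
    refine (hasDerivAt_integral_of_dominated_loc_of_deriv_le (Metric.ball_mem_nhds 0 one_pos)
      (F := fun τ y => φ y * Real.exp (τ * y)) (F' := fun τ y => φ y * (y * Real.exp (τ * y)))
      (bound := fun y => |φ y| * |y| * Real.exp (1 * y) + |φ y| * |y| * Real.exp ((-1) * y))
      (Eventually.of_forall fun τ => ?_) ?_ ?_ (Eventually.of_forall fun y τ hτ => ?_) ?_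
      (Eventually.of_forall fun y τ hτ => ?_)).2
    · have := hφ.continuous
      exact (by fun_prop : Continuous fun y => φ y * Real.exp (τ * y)).aestronglyMeasurable
    · exact hφ.integrable_mul_exp_gaussianReal 0
    · have := hφ.continuous
      exact (by fun_prop : Continuous fun y => φ y * (y * Real.exp (0 * y))).aestronglyMeasurable
    · have hτ' : |τ| < 1 := by simpa using hτ
      rw [norm_mul, norm_mul, Real.norm_eq_abs, Real.norm_eq_abs, Real.norm_eq_abs, Real.abs_exp,
        ← mul_add, ← mul_assoc]
      gcongr
      have h := abs_le.1 hτ'.le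
      rcases le_total 0 y with hy | hy
      · have : Real.exp (τ * y) ≤ Real.exp (1 * y) := by gcongr; exact h.2
        linarith [Real.exp_pos ((-1) * y)]
      · have : Real.exp (τ * y) ≤ Real.exp ((-1) * y) := by
          apply Real.exp_le_exp.2; nlinarith [h.1]
        linarith [Real.exp_pos (1 * y)]
    · exact (hφy.integrable_mul_exp_gaussianReal 1).add (hφy.integrable_mul_exp_gaussianReal (-1))
    · have : HasDerivAt (fun τ => Real.exp (τ * y)) (y * Real.exp (τ * y)) τ := by
        simpa [mul_comm] using ((hasDerivAt_id τ).mul_const y).exp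
      exact this.const_mul _
  have h2 : HasDerivAt (fun τ : ℝ => Real.exp (-(τ ^ 2 / 2))) 0 0 := by
    simpa using (((hasDerivAt_id (0:ℝ)).pow 2).div_const 2).neg.exp
  have h3 : HasDerivAt (fun τ : ℝ => Real.exp (-(τ ^ 2 / 2)) *
      ∫ y, φ y * Real.exp (τ * y) ∂(gaussianReal 0 1)) _ 0 := h2.mul h1
  simpa [mul_comm] using h3

/-- Stein's identity. -/
lemma integral_mul_gaussianReal {F F' : ℝ → ℝ} (hF : PolyGrowth F) (hF' : PolyGrowth F')
    (hd : ∀ t, HasDerivAt F (F' t) t) :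
    ∫ y, y * F y ∂(gaussianReal 0 1) = ∫ y, F' y ∂(gaussianReal 0 1) := by
  refine (hasDerivAt_integral_comp_add_gaussianReal hF).unique ?_
  simpa using hasDerivAt_integral_comp_add_mul hasAllMoments_gaussianReal hF hF' hd
    (X := fun y => y) (K := fun _ => 1) (by fun_prop) (by fun_prop) 0

/-! ### Linear combinations of one Gaussian and `n` exponential variables -/

/-- The coordinate laws: standard Gaussian at `none`, standard exponential at `some j`. -/
noncomputable def gaussExpLaw (n : ℕ) : Option (Fin n) → Measure ℝ
  | none => gaussianReal 0 1
  | some _ => expMeasure 1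

instance (n : ℕ) (i : Option (Fin n)) : IsProbabilityMeasure (gaussExpLaw n i) := by
  cases i <;> simp only [gaussExpLaw] <;> infer_instance

/-- The joint law of one standard Gaussian and `n` standard exponential variables, all
independent. -/
noncomputable def gaussExp (n : ℕ) : Measure (Option (Fin n) → ℝ) := Measure.pi (gaussExpLaw n)

instance (n : ℕ) : IsProbabilityMeasure (gaussExp n) := by
  unfold gaussExp; infer_instance

lemma hasAllMoments_gaussExpLaw (n : ℕ) (i : Option (Fin n)) : HasAllMoments (gaussExpLaw n i) := by
  cases i
  exacts [hasAllMoments_gaussianReal, hasAllMoments_expMeasure]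

lemma hasAllMoments_gaussExp (n : ℕ) : HasAllMoments (gaussExp n) :=
  HasAllMoments.pi (hasAllMoments_gaussExpLaw n)

/-- The affine form `a + ∑ i, c i * ω i`; under `gaussExp n` it is
`a + c none * G + ∑ j, c (some j) * E j`. -/
def affineForm {n : ℕ} (a : ℝ) (c ω : Option (Fin n) → ℝ) : ℝ := a + ∑ i, c i * ω i

variable {n : ℕ} (a : ℝ) (c : Option (Fin n) → ℝ)

@[fun_prop]
lemma PolyGrowth.affineForm {V : Type*} [NormedAddCommGroup V] {A : V → ℝ}
    {f g : V → Option (Fin n) → ℝ} (hA : PolyGrowth A) (hf : PolyGrowth f) (hg : PolyGrowth g) :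
    PolyGrowth (fun v => affineForm (A v) (f v) (g v)) := by
  unfold _root_.affineForm
  fun_prop

lemma affineForm_update (ω : Option (Fin n) → ℝ) (i : Option (Fin n)) (y : ℝ) :
    affineForm a c (Function.update ω i y) = affineForm a c ω - c i * ω i + c i * y := by
  simp only [affineForm, ← Finset.add_sum_erase _ _ (Finset.mem_univ i), Function.update_self]
  have : ∑ k ∈ Finset.univ.erase i, c k * Function.update ω i y k =
      ∑ k ∈ Finset.univ.erase i, c k * ω k :=
    Finset.sum_congr rfl fun k hk => by simp [Finset.ne_of_mem_erase hk]
  rw [this]; ring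

lemma affineForm_update_coeff (ω : Option (Fin n) → ℝ) (i : Option (Fin n)) (y : ℝ) :
    affineForm a (Function.update c i y) ω = affineForm a c ω + (y - c i) * ω i := by
  simp only [affineForm, ← Finset.add_sum_erase _ _ (Finset.mem_univ i), Function.update_self]
  have : ∑ k ∈ Finset.univ.erase i, Function.update c i y k * ω k =
      ∑ k ∈ Finset.univ.erase i, c k * ω k :=
    Finset.sum_congr rfl fun k hk => by simp [Finset.ne_of_mem_erase hk]
  rw [this]; ring

/-- Conditioning on all coordinates but `i`. -/
lemma integral_affineForm_eq (i : Option (Fin n)) {H : ℝ × ℝ → ℝ} (hH : PolyGrowth H) :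
    ∫ ω, H (affineForm a c ω, ω i) ∂(gaussExp n) =
      ∫ ω, ∫ y, H (affineForm a c ω - c i * ω i + c i * y, y) ∂(gaussExpLaw n i) ∂(gaussExp n) := by
  have := integral_update (hasAllMoments_gaussExpLaw n) i
    (F := fun ω => H (affineForm a c ω, ω i)) (by fun_prop)
  simp only [affineForm_update, Function.update_self] at this
  exact this

lemma integral_affineForm_eq_swap (i : Option (Fin n)) {H : ℝ × ℝ → ℝ} (hH : PolyGrowth H) :
    ∫ ω, H (affineForm a c ω, ω i) ∂(gaussExp n) =
      ∫ y, ∫ ω, H (affineForm a c ω - c i * ω i + c i * y, y) ∂(gaussExp n) ∂(gaussExpLaw n i) := by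
  rw [integral_affineForm_eq a c i hH, integral_integral_swap]
  exact PolyGrowth.integrable
    (F := fun x : (Option (Fin n) → ℝ) × ℝ =>
      H (affineForm a c x.1 - c i * x.1 i + c i * x.2, x.2)) (by fun_prop)
    ((hasAllMoments_gaussExp n).prod (hasAllMoments_gaussExpLaw n i))

/-- Integration by parts in an exponential coordinate: the centred variable `E j - 1` acts as
`c (some j) * E j` times a derivative. -/
lemma integral_some_sub_one_mul (j : Fin n) {F F' : ℝ → ℝ} (hF : PolyGrowth F)
    (hF' : PolyGrowth F') (hd : ∀ t, HasDerivAt F (F' t) t) :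
    ∫ ω, (ω (some j) - 1) * F (affineForm a c ω) ∂(gaussExp n) =
      c (some j) * ∫ ω, ω (some j) * F' (affineForm a c ω) ∂(gaussExp n) := by
  rw [integral_affineForm_eq a c (some j) (H := fun x => (x.2 - 1) * F x.1) (by fun_prop),
    integral_affineForm_eq a c (some j) (H := fun x => x.2 * F' x.1) (by fun_prop),
    ← integral_const_mul]
  congr 1
  ext ω
  set y₀ := affineForm a c ω - c (some j) * ω (some j)
  have := integral_sub_one_mul_expMeasure (F := fun y => F (y₀ + c (some j) * y))
    (F' := fun y => c (some j) * F' (y₀ + c (some j) * y)) (by fun_prop) (by fun_prop) fun t => by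
      have h1 : HasDerivAt (fun y => y₀ + c (some j) * y) (c (some j)) t := by
        simpa using ((hasDerivAt_id t).const_mul (c (some j))).const_add y₀
      rw [mul_comm]
      exact (hd _).comp t h1
  simp only [gaussExpLaw, ← integral_const_mul, mul_left_comm (c (some j))]
  exact this

/-- Stein's identity in the Gaussian coordinate. -/
lemma integral_none_mul {F F' : ℝ → ℝ} (hF : PolyGrowth F)
    (hF' : PolyGrowth F') (hd : ∀ t, HasDerivAt F (F' t) t) :
    ∫ ω, ω none * F (affineForm a c ω) ∂(gaussExp n) =
      c none * ∫ ω, F' (affineForm a c ω) ∂(gaussExp n) := by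
  rw [integral_affineForm_eq a c none (H := fun x => x.2 * F x.1) (by fun_prop),
    integral_affineForm_eq a c none (H := fun x => F' x.1) (by fun_prop),
    ← integral_const_mul]
  congr 1
  ext ω
  set y₀ := affineForm a c ω - c none * ω none
  have := integral_mul_gaussianReal (F := fun y => F (y₀ + c none * y))
    (F' := fun y => c none * F' (y₀ + c none * y)) (by fun_prop) (by fun_prop) fun t => by
      have h1 : HasDerivAt (fun y => y₀ + c none * y) (c none) t := by
        simpa using ((hasDerivAt_id t).const_mul (c none)).const_add y₀
      rw [mul_comm]
      exact (hd _).comp t h1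
  simp only [gaussExpLaw, ← integral_const_mul]
  exact this

/-- Weighting by `E j` amounts to adding an independent copy of `c (some j) * E j`. -/
lemma integral_some_mul (j : Fin n) {F : ℝ → ℝ} (hF : PolyGrowth F) :
    ∫ ω, ω (some j) * F (affineForm a c ω) ∂(gaussExp n) =
      ∫ y, ∫ ω, F (affineForm a c ω + c (some j) * y) ∂(gaussExp n) ∂(expMeasure 1) := by
  have hv : PolyGrowth (fun y => ∫ ω, F (affineForm a c ω - c (some j) * ω (some j) +
      c (some j) * y) ∂(gaussExp n)) :=
    PolyGrowth.integral_right (F := fun x : ℝ × (Option (Fin n) → ℝ) =>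
      F (affineForm a c x.2 - c (some j) * x.2 (some j) + c (some j) * x.1)) (by fun_prop)
      (hasAllMoments_gaussExp n)
  rw [integral_affineForm_eq_swap a c (some j) (H := fun x => x.2 * F x.1) (by fun_prop)]
  simp only [integral_const_mul, gaussExpLaw]
  rw [integral_mul_expMeasure hv]
  congr 1
  ext t
  rw [integral_affineForm_eq_swap a c (some j) (H := fun x => F (x.1 + c (some j) * t))
    (by fun_prop)]
  simp only [gaussExpLaw]
  congr 1
  ext y
  congr 1
  ext ω
  congr 1
  ring

/-- Differentiation along translations by multiples of `c none`; as the Gaussian density carries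
the derivative, `F` need not be differentiable. -/
lemma hasDerivAt_integral_affineForm_add {F : ℝ → ℝ} (hF : PolyGrowth F) :
    HasDerivAt (fun τ => ∫ ω, F (affineForm a c ω + c none * τ) ∂(gaussExp n))
      (∫ ω, ω none * F (affineForm a c ω) ∂(gaussExp n)) 0 := by
  have hv : PolyGrowth (fun y => ∫ ω, F (affineForm a c ω - c none * ω none +
      c none * y) ∂(gaussExp n)) :=
    PolyGrowth.integral_right (F := fun x : ℝ × (Option (Fin n) → ℝ) =>
      F (affineForm a c x.2 - c none * x.2 none + c none * x.1)) (by fun_prop)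
      (hasAllMoments_gaussExp n)
  have h := hasDerivAt_integral_comp_add_gaussianReal hv
  rw [integral_affineForm_eq_swap a c none (H := fun x => x.2 * F x.1) (by fun_prop)]
  simp only [integral_const_mul, gaussExpLaw]
  convert h using 1
  ext τ
  rw [integral_affineForm_eq_swap a c none (H := fun x => F (x.1 + c none * τ)) (by fun_prop)]
  simp only [gaussExpLaw, mul_add, add_assoc]

lemma hasDerivAt_integral_affineForm_const {F F' : ℝ → ℝ} (hF : PolyGrowth F)
    (hF' : PolyGrowth F') (hd : ∀ t, HasDerivAt F (F' t) t) :
    HasDerivAt (fun ε => ∫ ω, F (affineForm (a + ε) c ω) ∂(gaussExp n))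
      (∫ ω, F' (affineForm a c ω) ∂(gaussExp n)) 0 := by
  have := hasDerivAt_integral_comp_add_mul (hasAllMoments_gaussExp n) hF hF' hd
    (X := affineForm a c) (K := fun _ => 1) (by fun_prop) (by fun_prop) 0
  simp only [mul_one, add_zero, one_mul] at this
  convert this using 5
  simp only [affineForm]; ring

lemma hasDerivAt_integral_affineForm_coeff (i : Option (Fin n)) {F F' : ℝ → ℝ} (hF : PolyGrowth F)
    (hF' : PolyGrowth F') (hd : ∀ t, HasDerivAt F (F' t) t) :
    HasDerivAt
      (fun ε => ∫ ω, F (affineForm a (Function.update c i (c i + ε)) ω) ∂(gaussExp n))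
      (∫ ω, ω i * F' (affineForm a c ω) ∂(gaussExp n)) 0 := by
  have := hasDerivAt_integral_comp_add_mul (hasAllMoments_gaussExp n) hF hF' hd
    (X := affineForm a c) (K := fun ω => ω i) (by fun_prop) (by fun_prop) 0
  simp only [zero_mul, add_zero] at this
  convert this using 5
  rw [affineForm_update_coeff]; ring

/-! ### Sign changes of averages -/

lemma integral_pos_of_ae_pos {α : Type*} [MeasurableSpace α] {μ : Measure α}
    [IsProbabilityMeasure μ] {f : α → ℝ} (hf : Integrable f μ) (hpos : ∀ᵐ x ∂μ, 0 < f x) :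
    0 < ∫ x, f x ∂μ := by
  rw [integral_pos_iff_support_of_nonneg_ae (hpos.mono fun x hx => hx.le) hf]
  have : μ (Function.support f) = 1 := by
    rw [prob_compl_eq_zero_iff₀ ?_ |>.symm]
    · exact hpos.mono fun x hx => by simpa using hx.ne'
    · exact hf.aestronglyMeasurable.nullMeasurableSet_support
  rw [this]; exact one_pos

/-- `D` changes sign at most once, from negative to positive, and vanishes at most once. -/
def StrictSignChange (D : ℝ → ℝ) : Prop := ∀ t t', t < t' → 0 ≤ D t → 0 < D t'

lemma StrictSignChange.reflect {D : ℝ → ℝ} (h : StrictSignChange D) :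
    StrictSignChange fun t => - D (-t) := by
  intro t t' htt' ht
  by_contra! h'
  have := h (-t') (-t) (by linarith) (by linarith)
  linarith

/-- Averaging over a positive multiple of an exponential variable preserves single sign changes:
where `D` is negative to the left of `t'`, the average times `exp (-t / c)` is strictly increasing
up to `t'`. -/
lemma StrictSignChange.integral_expMeasure_of_pos {D : ℝ → ℝ} (h : StrictSignChange D)
    (hD : PolyGrowth D) {c : ℝ} (hc : 0 < c) :
    StrictSignChange fun t => ∫ y, D (t + c * y) ∂(expMeasure 1) := by
  intro t t' htt' ht
  by_cases h0 : 0 ≤ D t'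
  · refine integral_pos_of_ae_pos (PolyGrowth.integrable (by fun_prop) hasAllMoments_expMeasure) ?_
    filter_upwards [ae_pos_expMeasure_one] with y hy
    exact h t' _ (by nlinarith) h0
  · -- now `D` is negative to the left of `t'`
    push Not at h0
    have hneg : ∀ w, w < t' → D w < 0 := fun w hw => by
      by_contra! h1
      exact (h w t' hw h1).not_gt h0
    -- in the variable `t / c`, multiplying the average by `exp (-t / c)` gives a tail integral
    have key := exp_neg_mul_integral_sub (φ := fun w => D (c * w)) (by fun_prop) (t / c) (t' / c)
    have e : ∀ t, (fun y => D (c * (t / c + y))) = fun y => D (t + c * y) := fun t => by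
      ext y; congr 1; field_simp
    simp only [e] at key
    have hI : 0 < ∫ w in (t / c)..(t' / c), Real.exp (-w) * -D (c * w) := by
      refine intervalIntegral.intervalIntegral_pos_of_pos_on ?_ (fun w hw => ?_) (by gcongr)
      · have := hD.continuous
        exact (by fun_prop : Continuous fun w => Real.exp (-w) * -D (c * w)).intervalIntegrable _ _
      · have : c * w < t' := by
          have := (lt_div_iff₀ hc).1 hw.2
          linarith
        have := hneg _ this
        have := Real.exp_pos (-w)
        apply mul_pos this
        linarith
    simp only [mul_neg, intervalIntegral.integral_neg] at hI
    have h1 : 0 ≤ Real.exp (-(t / c)) * ∫ y, D (t + c * y) ∂(expMeasure 1) :=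
      mul_nonneg (Real.exp_pos _).le ht
    exact pos_of_mul_pos_right (by linarith :
      0 < Real.exp (-(t' / c)) * ∫ y, D (t' + c * y) ∂(expMeasure 1)) (Real.exp_pos _).le

lemma StrictSignChange.integral_expMeasure {D : ℝ → ℝ} (h : StrictSignChange D)
    (hD : PolyGrowth D) (c : ℝ) :
    StrictSignChange fun t => ∫ y, D (t + c * y) ∂(expMeasure 1) := by
  rcases lt_trichotomy c 0 with hc | rfl | hc
  · have := (h.reflect.integral_expMeasure_of_pos (by fun_prop) (neg_pos.2 hc)).reflect
    convert this using 2
    rw [← integral_neg]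
    congr 1
    ext y
    rw [neg_neg]
    congr 1; ring
  · simpa using h
  · exact h.integral_expMeasure_of_pos hD hc

/-- Averaging over a Gaussian variable preserves single sign changes, by the monotone likelihood
ratio of the Gaussian translates. -/
lemma strictSignChange_integral_gaussianReal {D : ℝ → ℝ} {z : ℝ}
    (h : ∀ w, w ≠ z → 0 < D w * (w - z)) (hD : PolyGrowth D) (s : ℝ) :
    StrictSignChange fun t => ∫ y, D (t + s * y) ∂(gaussianReal 0 1) := by
  intro t t' htt' ht
  by_cases hs : s = 0
  · subst hs
    simp only [zero_mul, add_zero, integral_const, probReal_univ, one_smul] at ht ⊢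
    have h1 : z ≤ t := by
      by_contra! h1
      have := h t h1.ne
      nlinarith
    have := h t' (by linarith : z < t').ne'
    exact pos_of_mul_pos_left this (by linarith)
  · set τ := (t' - t) / s with hτ
    -- the zero of `y ↦ D (t + s * y)`
    set y₀ := (z - t) / s with hy₀
    have e : (fun y => D (t' + s * y)) = fun y => D (t + s * (y + τ)) := by
      ext y; congr 1; rw [hτ]; field_simp; ring
    have hφ : PolyGrowth fun y => D (t + s * y) := by fun_prop
    have key := integral_comp_add_gaussianReal (fun y => D (t + s * y)) τ
    simp only [e]
    rw [key]
    refine mul_pos (Real.exp_pos _) ?_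
    have hi := hφ.integrable_mul_exp_gaussianReal τ
    have hi' := (hφ.integrable hasAllMoments_gaussianReal).mul_const (Real.exp (τ * y₀))
    have hpos : 0 < ∫ y, (D (t + s * y) * Real.exp (τ * y) -
        D (t + s * y) * Real.exp (τ * y₀)) ∂(gaussianReal 0 1) := by
      refine integral_pos_of_ae_pos (hi.sub hi') ?_
      have hne : ∀ᵐ y ∂(gaussianReal 0 1), y ≠ y₀ := by
        have := nullSingletonClass_gaussianReal (μ := 0) (v := 1) one_ne_zero
        simp [ae_iff]
      filter_upwards [hne] with y hy
      rw [← mul_sub]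
      have e1 : s * y₀ = z - t := by rw [hy₀]; field_simp
      have e2 : s * τ = t' - t := by rw [hτ]; field_simp
      have h1 := h (t + s * y) fun h0 => hy (mul_left_cancel₀ hs (by linarith))
      have e3 : t + s * y - z = s * (y - y₀) := by linarith
      rw [e3] at h1
      have e4 : 0 < (s * (y - y₀)) * (Real.exp (τ * y) - Real.exp (τ * y₀)) := by
        rcases lt_or_gt_of_ne hs with hs | hs
        · have hτ0 : τ < 0 := by nlinarith
          rcases lt_or_gt_of_ne hy with hy | hy
          · exact mul_pos (by nlinarith) (sub_pos.2 (Real.exp_lt_exp.2 (by nlinarith)))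
          · exact mul_pos_of_neg_of_neg (by nlinarith)
              (sub_neg.2 (Real.exp_lt_exp.2 (by nlinarith)))
        · have hτ0 : 0 < τ := by nlinarith
          rcases lt_or_gt_of_ne hy with hy | hy
          · exact mul_pos_of_neg_of_neg (by nlinarith)
              (sub_neg.2 (Real.exp_lt_exp.2 (by nlinarith)))
          · exact mul_pos (by nlinarith) (sub_pos.2 (Real.exp_lt_exp.2 (by nlinarith)))
      have h5 := mul_pos h1 e4
      have h6 : s * (y - y₀) ≠ 0 := by rintro h0; simp [h0] at h1
      have h7 : 0 < (s * (y - y₀)) ^ 2 := by positivity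
      refine pos_of_mul_pos_right (a := (s * (y - y₀)) ^ 2) ?_ h7.le
      linarith
    rw [integral_sub hi hi', integral_mul_const] at hpos
    have := mul_nonneg ht (Real.exp_pos (τ * y₀)).le
    linarith

lemma strictSignChange_integral_affineForm {n : ℕ} {D : ℝ → ℝ} {z : ℝ}
    (h : ∀ w, w ≠ z → 0 < D w * (w - z)) (hD : PolyGrowth D) (c : Option (Fin n) → ℝ) :
    StrictSignChange fun t => ∫ ω, D (affineForm t c ω) ∂(gaussExp n) := by
  -- the exponential variables are switched on one at a time
  suffices H : ∀ A : Finset (Fin n), StrictSignChange fun t => ∫ ω, D (affineForm t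
      (fun i => i.elim (c none) fun j => if j ∈ A then c (some j) else 0) ω) ∂(gaussExp n) by
    convert H Finset.univ with t ω
    cases ‹Option (Fin n)› <;> simp
  intro A
  induction A using Finset.induction_on with
  | empty =>
    convert strictSignChange_integral_gaussianReal h hD (c none) using 2 with t
    rw [integral_affineForm_eq t _ none (H := fun x => D x.1) (by fun_prop)]
    simp [affineForm, Fintype.sum_option, gaussExpLaw]
  | insert j A hj ih =>
    have hV : ∀ c' : Option (Fin n) → ℝ, PolyGrowth fun x : ℝ × (Option (Fin n) → ℝ) =>
        D (affineForm x.1 c' x.2) := fun c' => by fun_prop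
    convert ih.integral_expMeasure (PolyGrowth.integral_right (hV _)
      (hasAllMoments_gaussExp n)) (c (some j)) using 2 with t
    rw [integral_affineForm_eq_swap t _ (some j) (H := fun x => D x.1) (by fun_prop)]
    simp only [gaussExpLaw]
    congr 1
    ext y
    congr 1
    ext ω
    congr 1
    simp only [affineForm, Fintype.sum_option, Option.elim,
      ← Finset.add_sum_erase _ _ (Finset.mem_univ j), Finset.mem_insert_self, if_true, hj, if_false]
    have : ∑ k ∈ Finset.univ.erase j, (if k ∈ insert j A then c (some k) else 0) * ω (some k) =
        ∑ k ∈ Finset.univ.erase j, (if k ∈ A then c (some k) else 0) * ω (some k) :=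
      Finset.sum_congr rfl fun k hk => by simp [Finset.mem_insert, Finset.ne_of_mem_erase hk]
    rw [this]; ring

/-- If all increments of `u` over intervals of a fixed length change sign once, and `u` has a
minimiser `t₀ ≥ 0`, then `u` exceeds `u 0` on the negative half line. -/
lemma lt_of_strictSignChange_of_min {u : ℝ → ℝ}
    (h : ∀ δ, 0 < δ → StrictSignChange fun t => u (t + δ) - u t) {t₀ : ℝ} (hmin : ∀ t, u t₀ ≤ u t)
    (h0 : 0 ≤ t₀) {t : ℝ} (ht : t < 0) : u 0 < u t := by
  by_contra! hle
  rcases h0.eq_or_lt with rfl | h0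
  · -- otherwise `t` is a second minimiser, and `u` increases strictly from `t / 2` to `0`
    have h1 := h (-t / 2) (by linarith) t (t / 2) (by linarith) (by linarith [hmin (t + -t / 2)])
    have h2 := hmin (t / 2)
    have e : t / 2 + -t / 2 = 0 := by ring
    simp only [e] at h1
    linarith
  · have h1 := h (-t) (by linarith) t (t₀ + t) (by linarith) (by simpa using hle)
    simp only [add_neg_cancel_right] at h1
    linarith [hmin (t₀ + t)]

/-- The function `t ↦ E |X + t| ^ q` is strictly monotone on both sides of its minimum; hence
it exceeds its value at `0` at all points of one of the two half lines. -/
lemma integral_abs_rpow_affineForm_lt {n : ℕ} {q : ℝ} (hq : 0 < q) (a : ℝ)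
    (c : Option (Fin n) → ℝ) :
    (∀ t < 0, ∫ ω, |affineForm a c ω| ^ q ∂(gaussExp n) <
      ∫ ω, |affineForm a c ω + t| ^ q ∂(gaussExp n)) ∨
    (∀ t > 0, ∫ ω, |affineForm a c ω| ^ q ∂(gaussExp n) <
      ∫ ω, |affineForm a c ω + t| ^ q ∂(gaussExp n)) := by
  have hu : PolyGrowth (fun t => ∫ ω, |affineForm a c ω + t| ^ q ∂(gaussExp n)) :=
    PolyGrowth.integral_right (F := fun x : ℝ × (Option (Fin n) → ℝ) =>
      |affineForm a c x.2 + x.1| ^ q) (PolyGrowth.abs_rpow (by fun_prop) hq.le)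
      (hasAllMoments_gaussExp n)
  set u : ℝ → ℝ := fun t => ∫ ω, |affineForm a c ω + t| ^ q ∂(gaussExp n) with hudef
  have hint : ∀ t, Integrable (fun ω => |affineForm a c ω + t| ^ q) (gaussExp n) := fun t =>
    (PolyGrowth.abs_rpow (by fun_prop) hq.le).integrable (hasAllMoments_gaussExp n)
  have hsc : ∀ δ, 0 < δ → StrictSignChange fun t => u (t + δ) - u t := by
    intro δ hδ
    have h1 : PolyGrowth (fun w : ℝ => |w + δ| ^ q) := PolyGrowth.abs_rpow (by fun_prop) hq.le
    have h2 : PolyGrowth (fun w : ℝ => |w| ^ q) := PolyGrowth.abs_rpow (by fun_prop) hq.le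
    have := strictSignChange_integral_affineForm (n := n)
      (D := fun w => |w + δ| ^ q - |w| ^ q) (z := -δ / 2) ?_ (by fun_prop) c
    · intro t t' htt' ht
      have h3 := this (a + t) (a + t') (by linarith)
      have e : ∀ t, ∫ ω, (|affineForm (a + t) c ω + δ| ^ q - |affineForm (a + t) c ω| ^ q)
          ∂(gaussExp n) = u (t + δ) - u t := fun t => by
        rw [hudef, ← integral_sub (hint _) (hint _)]
        congr 1
        ext ω
        simp only [affineForm]
        congr 3 <;> ring
      simp only [e] at h3
      exact h3 ht
    · intro w hw
      rcases lt_or_gt_of_ne hw with hw | hw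
      · refine mul_pos_of_neg_of_neg (sub_neg.2 (Real.rpow_lt_rpow (abs_nonneg _) ?_ hq))
          (by linarith)
        rw [abs_lt, abs_of_neg (by linarith : w < 0)]
        constructor <;> linarith
      · refine mul_pos (sub_pos.2 (Real.rpow_lt_rpow (abs_nonneg _) ?_ hq)) (by linarith)
        rw [abs_lt, abs_of_pos (by linarith : 0 < w + δ)]
        constructor <;> linarith
  obtain ⟨t₀, ht₀⟩ : ∃ t₀, ∀ t, u t₀ ≤ u t := by
    refine hu.continuous.exists_forall_le ?_
    have hlow : ∀ t, (|t| / 2) ^ q - u 0 ≤ u t := fun t => by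
      rw [sub_le_iff_le_add, hudef, ← integral_add (hint _) (hint _)]
      have : (|t| / 2) ^ q = ∫ ω, (|t| / 2) ^ q ∂(gaussExp n) := by simp
      rw [this]
      refine integral_mono (integrable_const _) ((hint _).add (hint _)) fun ω => ?_
      have h1 : |t| ≤ |affineForm a c ω + t| + |affineForm a c ω + 0| := by
        have := abs_sub (affineForm a c ω + t) (affineForm a c ω + 0)
        simpa using this
      rcases le_total (|t| / 2) |affineForm a c ω + t| with h2 | h2
      · exact (Real.rpow_le_rpow (by positivity) h2 hq.le).trans
          (le_add_of_nonneg_right (by positivity))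
      · exact (Real.rpow_le_rpow (by positivity) (by linarith) hq.le).trans
          (le_add_of_nonneg_left (by positivity))
    refine tendsto_atTop_mono hlow (tendsto_atTop_add_const_right _ _ ?_)
    exact (tendsto_rpow_atTop hq).comp
      ((tendsto_norm_cocompact_atTop (E := ℝ)).atTop_div_const two_pos)
  have hu0 : ∫ ω, |affineForm a c ω| ^ q ∂(gaussExp n) = u 0 := by simp [hudef]
  rw [hu0]
  rcases le_total 0 t₀ with h0 | h0
  · exact Or.inl fun t ht => lt_of_strictSignChange_of_min hsc ht₀ h0 ht
  · refine Or.inr fun t ht => ?_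
    have := lt_of_strictSignChange_of_min (u := fun t => u (-t)) (t₀ := -t₀) (fun δ hδ => ?_)
      (by simpa using fun t => ht₀ (-t)) (by linarith) (t := -t) (by linarith)
    · simpa using this
    · intro t t' htt' h
      have := (hsc δ hδ).reflect (t + δ) (t' + δ) (by linarith)
      have e : ∀ t, -(t + δ) + δ = -t := fun t => by ring
      simp only [e, neg_sub] at this
      exact this h

/-! ### Signed powers -/

lemma hasDerivAt_mul_abs_rpow {ρ : ℝ} (hρ : 0 ≤ ρ) (t : ℝ) :
    HasDerivAt (fun t => t * |t| ^ ρ) ((ρ + 1) * |t| ^ ρ) t := by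
  rcases hρ.eq_or_lt with rfl | hρ
  · simpa using hasDerivAt_id' t
  rcases eq_or_ne t 0 with rfl | ht
  · rw [hasDerivAt_iff_tendsto_slope]
    have h1 : Tendsto (fun t : ℝ => |t| ^ ρ) (𝓝[≠] 0) (𝓝 ((ρ + 1) * |0| ^ ρ)) := by
      have : Continuous fun t : ℝ => |t| ^ ρ := by fun_prop (disch := simp [hρ.le])
      have := this.tendsto 0
      simp only [abs_zero, Real.zero_rpow hρ.ne', mul_zero] at this ⊢
      exact this.mono_left nhdsWithin_le_nhds
    refine h1.congr' ?_
    filter_upwards [self_mem_nhdsWithin] with t ht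
    have ht : t ≠ 0 := ht
    simp [slope_def_field, mul_div_cancel_left₀ _ ht]
  · have h1 := (hasDerivAt_id' t).mul ((hasDerivAt_abs ht).rpow_const (p := ρ)
      (Or.inl (abs_ne_zero.2 ht)))
    refine HasDerivAt.congr_deriv (f := fun t => t * |t| ^ ρ) h1 ?_
    have h2 : |t| ^ ρ = |t| ^ (ρ - 1) * |t| := by
      rw [← Real.rpow_add_one (abs_ne_zero.2 ht)]; simp
    have h3 : t * (SignType.sign t : ℝ) = |t| := by rw [mul_comm]; exact sign_mul_self t
    rw [h2]
    linear_combination (ρ * |t| ^ (ρ - 1)) * h3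

lemma PolyGrowth.mul_abs_rpow {ρ : ℝ} (hρ : 0 ≤ ρ) : PolyGrowth (fun t : ℝ => t * |t| ^ ρ) :=
  PolyGrowth.id.mul (PolyGrowth.abs_rpow PolyGrowth.id hρ)

lemma strictMono_mul_abs_rpow {ρ : ℝ} (hρ : 0 ≤ ρ) : StrictMono (fun t : ℝ => t * |t| ^ ρ) := by
  rcases hρ.eq_or_lt with rfl | hρ'
  · intro a b h
    simpa using h
  have h0 : ∀ t : ℝ, 0 ≤ t → t * |t| ^ ρ = t ^ (ρ + 1) := fun t ht => by
    rcases ht.eq_or_lt with rfl | ht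
    · rw [Real.zero_rpow (by linarith)]; simp
    · rw [abs_of_pos ht, Real.rpow_add_one ht.ne', mul_comm]
  intro t t' h
  simp only
  rcases le_or_gt 0 t with ht | ht
  · rw [h0 t ht, h0 t' (ht.trans h.le)]
    exact Real.rpow_lt_rpow ht h (by linarith)
  · have e : ∀ t : ℝ, t * |t| ^ ρ = -(-t * |-t| ^ ρ) := fun t => by simp
    rcases le_or_gt 0 t' with ht' | ht'
    · have h1 : t * |t| ^ ρ < 0 := mul_neg_of_neg_of_pos ht
        (Real.rpow_pos_of_pos (abs_pos.2 ht.ne) _)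
      exact h1.trans_le (mul_nonneg ht' (by positivity))
    · rw [e t, e t', h0 (-t) (by linarith), h0 (-t') (by linarith), neg_lt_neg_iff]
      exact Real.rpow_lt_rpow (by linarith) (by linarith) (by linarith)

lemma sub_sin_nonneg {t : ℝ} (ht : 0 ≤ t) : 0 ≤ t - Real.sin t := by
  linarith [Real.sin_le ht]

lemma integrableOn_sub_sin_mul_rpow {ρ : ℝ} (h0 : 0 < ρ) (h2 : ρ < 2) :
    IntegrableOn (fun t : ℝ => (t - Real.sin t) * t ^ (-ρ - 2)) (Set.Ioi 0) := by
  have hm : ∀ s : Set ℝ, AEStronglyMeasurable (fun t : ℝ => (t - Real.sin t) * t ^ (-ρ - 2))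
      (volume.restrict s) := fun s =>
    (by fun_prop : Measurable fun t : ℝ => (t - Real.sin t) * t ^ (-ρ - 2)).aestronglyMeasurable
  rw [← Set.Ioc_union_Ioi_eq_Ioi (zero_le_one (α := ℝ))]
  refine IntegrableOn.union ?_ ?_
  · have h1 : IntegrableOn (fun t : ℝ => t ^ (1 - ρ)) (Set.Ioc 0 1) := by
      have := intervalIntegral.intervalIntegrable_rpow' (a := 0) (b := 1)
        (by linarith : -1 < 1 - ρ)
      rwa [intervalIntegrable_iff_integrableOn_Ioc_of_le zero_le_one] at this
    refine Integrable.mono' h1 (hm _) ?_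
    filter_upwards [ae_restrict_mem measurableSet_Ioc] with t ht
    have h3 := Real.sin_gt_sub_cube ht.1
    rw [Real.norm_of_nonneg (mul_nonneg (sub_sin_nonneg ht.1.le) (Real.rpow_nonneg ht.1.le _)),
      show 1 - ρ = 3 + (-ρ - 2) by ring, Real.rpow_add ht.1]
    gcongr
    · exact Real.rpow_nonneg ht.1.le _
    · rw [show (3 : ℝ) = (3 : ℕ) by norm_num, Real.rpow_natCast]
      have : 0 < t ^ 3 := pow_pos ht.1 3
      linarith
  · have h1 : IntegrableOn (fun t : ℝ => 2 * t ^ (-ρ - 1)) (Set.Ioi 1) :=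
      (integrableOn_Ioi_rpow_of_lt (by linarith) one_pos).const_mul 2
    refine Integrable.mono' h1 (hm _) ?_
    filter_upwards [ae_restrict_mem measurableSet_Ioi] with t ht
    have ht1 : 1 < t := ht
    have ht0 : 0 < t := by linarith
    rw [Real.norm_of_nonneg (mul_nonneg (sub_sin_nonneg ht0.le) (Real.rpow_nonneg ht0.le _)),
      show -ρ - 1 = 1 + (-ρ - 2) by ring, Real.rpow_add ht0, Real.rpow_one, ← mul_assoc]
    gcongr
    linarith [Real.neg_one_le_sin t]

lemma integral_sub_sin_mul_rpow_pos {ρ : ℝ} (h0 : 0 < ρ) (h2 : ρ < 2) :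
    0 < ∫ t in Set.Ioi 0, (t - Real.sin t) * t ^ (-ρ - 2) := by
  rw [setIntegral_pos_iff_support_of_nonneg_ae _ (integrableOn_sub_sin_mul_rpow h0 h2)]
  · have : Set.Ioi 0 ⊆ Function.support (fun t : ℝ => (t - Real.sin t) * t ^ (-ρ - 2)) := by
      intro t ht
      have ht : 0 < t := ht
      have := Real.sin_lt ht
      exact (mul_pos (by linarith) (Real.rpow_pos_of_pos ht _)).ne'
    rw [Set.inter_eq_right.2 this]
    simp
  · filter_upwards [ae_restrict_mem measurableSet_Ioi] with t ht
    have ht : 0 < t := ht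
    exact mul_nonneg (sub_sin_nonneg ht.le) (Real.rpow_nonneg ht.le _)

lemma integrableOn_and_integral_sub_sin_of_pos {ρ : ℝ} (h0 : 0 < ρ) (h2 : ρ < 2) {x : ℝ}
    (hx : 0 < x) :
    IntegrableOn (fun t : ℝ => (t * x - Real.sin (t * x)) * t ^ (-ρ - 2)) (Set.Ioi 0) ∧
    ∫ t in Set.Ioi 0, (t * x - Real.sin (t * x)) * t ^ (-ρ - 2) =
      (∫ t in Set.Ioi 0, (t - Real.sin t) * t ^ (-ρ - 2)) * (x * |x| ^ ρ) := by
  have e : ∀ t ∈ Set.Ioi (0 : ℝ), x ^ (ρ + 2) * ((t * x - Real.sin (t * x)) * (t * x) ^ (-ρ - 2)) =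
      (t * x - Real.sin (t * x)) * t ^ (-ρ - 2) := fun t ht => by
    rw [Real.mul_rpow (le_of_lt ht) hx.le]
    have : x ^ (ρ + 2) * x ^ (-ρ - 2) = 1 := by
      rw [← Real.rpow_add hx]; ring_nf; simp
    linear_combination ((t * x - Real.sin (t * x)) * t ^ (-ρ - 2)) * this
  constructor
  · have := (integrableOn_Ioi_comp_mul_right_iff
      (fun t : ℝ => (t - Real.sin t) * t ^ (-ρ - 2)) 0 hx).2
      (by simpa using integrableOn_sub_sin_mul_rpow h0 h2)
    exact IntegrableOn.congr_fun (this.const_mul (x ^ (ρ + 2))) e measurableSet_Ioi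
  · rw [← setIntegral_congr_fun measurableSet_Ioi e, integral_const_mul,
      integral_comp_mul_right_Ioi (fun t : ℝ => (t - Real.sin t) * t ^ (-ρ - 2)) 0 hx, zero_mul,
      abs_of_pos hx, smul_eq_mul]
    have : x ^ (ρ + 2) * x⁻¹ = x * x ^ ρ := by
      rw [show ρ + 2 = ρ + 1 + 1 by ring, Real.rpow_add_one hx.ne', Real.rpow_add_one hx.ne']
      field_simp
    rw [← mul_assoc, this, mul_comm]

/-- Signed powers of exponent between `1` and `3` as mixtures of `x ↦ t * x - sin (t * x)`. -/
lemma integrableOn_and_integral_sub_sin {ρ : ℝ} (h0 : 0 < ρ) (h2 : ρ < 2) (x : ℝ) :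
    IntegrableOn (fun t : ℝ => (t * x - Real.sin (t * x)) * t ^ (-ρ - 2)) (Set.Ioi 0) ∧
    ∫ t in Set.Ioi 0, (t * x - Real.sin (t * x)) * t ^ (-ρ - 2) =
      (∫ t in Set.Ioi 0, (t - Real.sin t) * t ^ (-ρ - 2)) * (x * |x| ^ ρ) := by
  rcases lt_trichotomy x 0 with hx | rfl | hx
  · obtain ⟨h3, h4⟩ := integrableOn_and_integral_sub_sin_of_pos h0 h2 (neg_pos.2 hx)
    have e : (fun t : ℝ => (t * x - Real.sin (t * x)) * t ^ (-ρ - 2)) =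
        fun t => -((t * -x - Real.sin (t * -x)) * t ^ (-ρ - 2)) := by
      ext t; rw [mul_neg, Real.sin_neg]; ring
    rw [e]
    refine ⟨h3.neg, ?_⟩
    rw [integral_neg, h4, abs_neg]; ring
  · simp
  · exact integrableOn_and_integral_sub_sin_of_pos h0 h2 hx

/-! ### An oscillating integral -/

/-- Integrals of `sin Θ` against a decreasing weight are positive: the weight relative to `Θ` is
`W`, and the primitive `1 - cos Θ` of `Θ' * sin Θ` is nonnegative. -/
lemma integral_mul_sin_pos {Θ Θ' W : ℝ → ℝ} (hΘ : ∀ t, HasDerivAt Θ (Θ' t) t)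
    (hΘ'c : Continuous Θ') (hΘ' : ∀ t, 0 < t → 0 < Θ' t) (hΘ0 : Θ 0 = 0)
    (hΘt : Tendsto Θ atTop atTop) (hW : StrictAntiOn W (Set.Ioi 0)) (hW0 : ∀ t, 0 < t → 0 ≤ W t)
    (hWd : ∀ t, 0 < t → DifferentiableAt ℝ W t)
    (hint : IntegrableOn (fun t => W t * (Θ' t * Real.sin (Θ t))) (Set.Ioi 0)) :
    0 < ∫ t in Set.Ioi 0, W t * (Θ' t * Real.sin (Θ t)) := by
  have hΘc : Continuous Θ := continuous_iff_continuousAt.2 fun t => (hΘ t).continuousAt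
  have hmono : StrictMonoOn Θ (Set.Ici 0) :=
    strictMonoOn_of_deriv_pos (convex_Ici 0) hΘc.continuousOn fun t ht => by
      rw [interior_Ici] at ht
      rw [(hΘ t).deriv]; exact hΘ' t ht
  -- split at the point `t₁` where `1 - cos Θ` attains its maximum
  obtain ⟨t₁, ht₁, hΘt₁⟩ : ∃ t₁, 0 < t₁ ∧ Θ t₁ = Real.pi := by
    obtain ⟨T, hT⟩ := ((hΘt.eventually_ge_atTop Real.pi).and (eventually_ge_atTop 0)).exists
    obtain ⟨t₁, h1, h2⟩ := intermediate_value_Icc hT.2 hΘc.continuousOn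
      (show Real.pi ∈ Set.Icc (Θ 0) (Θ T) from ⟨by rw [hΘ0]; exact Real.pi_pos.le, hT.1⟩)
    refine ⟨t₁, h1.1.lt_of_ne ?_, h2⟩
    rintro rfl
    exact Real.pi_pos.ne (hΘ0.symm.trans h2)
  set V : ℝ → ℝ := fun t => 1 - Real.cos (Θ t)
  have hV : ∀ t, HasDerivAt V (Θ' t * Real.sin (Θ t)) t := fun t => by
    have := ((hΘ t).cos).const_sub 1
    refine this.congr_deriv ?_
    ring
  have hV0 : ∀ t, 0 ≤ V t := fun t => sub_nonneg.2 (Real.cos_le_one _)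
  have hV'c : Continuous fun t => Θ' t * Real.sin (Θ t) := by fun_prop
  have hWc : ContinuousOn W (Set.Ioi 0) := fun t ht => (hWd t ht).continuousAt.continuousWithinAt
  have hVt₁ : V t₁ = 2 := by simp [V, hΘt₁]; norm_num
  rw [← Set.Ioc_union_Ioi_eq_Ioi ht₁.le, setIntegral_union Set.Ioc_disjoint_Ioi_same
    measurableSet_Ioi (hint.mono_set Set.Ioc_subset_Ioi_self)
    (hint.mono_set (Set.Ioi_subset_Ioi ht₁.le))]
  have h1 : W t₁ * 2 < ∫ t in Set.Ioc 0 t₁, W t * (Θ' t * Real.sin (Θ t)) := by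
    have hi : IntervalIntegrable (fun t => W t * (Θ' t * Real.sin (Θ t))) volume 0 t₁ :=
      (intervalIntegrable_iff_integrableOn_Ioc_of_le ht₁.le).2
        (hint.mono_set Set.Ioc_subset_Ioi_self)
    have hi' : IntervalIntegrable (fun t => W t₁ * (Θ' t * Real.sin (Θ t))) volume 0 t₁ :=
      (by fun_prop : Continuous _).intervalIntegrable _ _
    have hpos : 0 < ∫ t in (0:ℝ)..t₁, (W t * (Θ' t * Real.sin (Θ t)) -
        W t₁ * (Θ' t * Real.sin (Θ t))) := by
      refine intervalIntegral.intervalIntegral_pos_of_pos_on (hi.sub hi') (fun t ht => ?_) ht₁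
      rw [← sub_mul]
      have h3 : Θ t < Real.pi := hΘt₁ ▸ hmono ht.1.le ht₁.le ht.2
      have h4 : 0 < Θ t := hΘ0 ▸ hmono (Set.self_mem_Ici) ht.1.le ht.1
      exact mul_pos (sub_pos.2 (hW ht.1 ht₁ ht.2))
        (mul_pos (hΘ' t ht.1) (Real.sin_pos_of_pos_of_lt_pi h4 h3))
    rw [intervalIntegral.integral_sub hi hi', intervalIntegral.integral_const_mul,
      intervalIntegral.integral_eq_sub_of_hasDerivAt (fun t _ => hV t)
        (hV'c.intervalIntegrable _ _), hVt₁, intervalIntegral.integral_of_le ht₁.le] at hpos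
    have : V 0 = 0 := by simp [V, hΘ0]
    rw [this] at hpos
    linarith
  have h2 : -(W t₁ * 2) ≤ ∫ t in Set.Ioi t₁, W t * (Θ' t * Real.sin (Θ t)) := by
    refine ge_of_tendsto (intervalIntegral_tendsto_integral_Ioi t₁
      (hint.mono_set (Set.Ioi_subset_Ioi ht₁.le)) tendsto_id) ?_
    filter_upwards [eventually_ge_atTop t₁] with T hT
    have hc : ContinuousOn (fun t => W t * (Θ' t * Real.sin (Θ t))) (Set.Ioi 0) :=
      hWc.mul hV'c.continuousOn
    have hder : ∀ t, t₁ < t → HasDerivAt (fun T => (∫ t in t₁..T, W t * (Θ' t * Real.sin (Θ t))) -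
        W T * V T) (-(deriv W t * V t)) t := fun t ht => by
      have ht0 : 0 < t := ht₁.trans ht
      have e1 := intervalIntegral.integral_hasDerivAt_right
        (f := fun t => W t * (Θ' t * Real.sin (Θ t))) (a := t₁) (b := t)
        ((hc.mono fun s hs => by
          rw [Set.uIcc_of_le ht.le] at hs
          exact ht₁.trans_le hs.1).intervalIntegrable)
        (hc.stronglyMeasurableAtFilter isOpen_Ioi t ht0) (hc.continuousAt (Ioi_mem_nhds ht0))
      refine (e1.sub ((hWd t ht0).hasDerivAt.mul (hV t))).congr_deriv ?_
      ring
    have hmon : MonotoneOn (fun T => (∫ t in t₁..T, W t * (Θ' t * Real.sin (Θ t))) -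
        W T * V T) (Set.Ici t₁) := by
      refine monotoneOn_of_deriv_nonneg (convex_Ici _) ?_ ?_ ?_
      · refine ContinuousOn.sub ?_ ((hWc.mono fun s hs => ht₁.trans_le hs).mul
          (continuous_iff_continuousAt.2 fun t => (hV t).continuousAt).continuousOn)
        intro t ht
        refine ContinuousAt.continuousWithinAt ?_
        have ht0 : 0 < t := ht₁.trans_le ht
        exact (intervalIntegral.integral_hasDerivAt_right
          (f := fun t => W t * (Θ' t * Real.sin (Θ t))) (a := t₁) (b := t)
          ((hc.mono fun s hs => by
            rw [Set.uIcc_of_le ht] at hs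
            exact ht₁.trans_le hs.1).intervalIntegrable)
          (hc.stronglyMeasurableAtFilter isOpen_Ioi t ht0)
          (hc.continuousAt (Ioi_mem_nhds ht0))).continuousAt
      · intro t ht
        rw [interior_Ici] at ht
        exact (hder t ht).differentiableAt.differentiableWithinAt
      · intro t ht
        rw [interior_Ici] at ht
        rw [(hder t ht).deriv]
        have : deriv W t ≤ 0 := by
          rw [← derivWithin_of_isOpen isOpen_Ioi (ht₁.trans ht : t ∈ Set.Ioi 0)]
          exact hW.antitoneOn.derivWithin_nonpos
        have := mul_nonneg (neg_nonneg.2 this) (hV0 t)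
        linarith
    have := hmon Set.self_mem_Ici hT hT
    simp only [intervalIntegral.integral_same, hVt₁] at this
    have h3 := mul_nonneg (hW0 T (ht₁.trans_le hT)) (hV0 T)
    simp only [id]
    linarith
  linarith

/-! ### Characteristic functions -/

lemma charFun_expMeasure (u : ℝ) : charFun (expMeasure 1) u = (1 - u * Complex.I)⁻¹ := by
  rw [charFun_apply_real, integral_expMeasure_one]
  have e : ∀ y : ℝ, Real.exp (-y) • Complex.exp (u * y * Complex.I) =
      Complex.exp ((-1 + u * Complex.I) * y) := fun y => by
    rw [Complex.real_smul, Complex.ofReal_exp, ← Complex.exp_add]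
    congr 1; push_cast; ring
  simp only [e]
  rw [integral_exp_mul_complex_Ioi (by simp)]
  simp only [Complex.ofReal_zero, mul_zero, Complex.exp_zero]
  rw [neg_div, ← div_neg, one_div]
  congr 1; ring

/-- The polar form of the characteristic function of the standard exponential law. -/
lemma charFun_expMeasure_eq_polar (u : ℝ) : charFun (expMeasure 1) u =
    ((√(1 + u ^ 2))⁻¹ : ℝ) * Complex.exp (Real.arctan u * Complex.I) := by
  rw [charFun_expMeasure, Complex.exp_mul_I, ← Complex.ofReal_cos, ← Complex.ofReal_sin,
    Real.cos_arctan, Real.sin_arctan]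
  have h0 : (0 : ℝ) < 1 + u ^ 2 := by positivity
  have h1 : √(1 + u ^ 2) ^ 2 = 1 + u ^ 2 := Real.sq_sqrt h0.le
  have h2 : (1 - u * Complex.I) * (1 + u * Complex.I) = ((1 + u ^ 2 : ℝ) : ℂ) := by
    push_cast
    linear_combination (-(u : ℂ) ^ 2) * Complex.I_sq
  have h3 : (1 - u * Complex.I) ≠ 0 := by
    intro h
    rw [h, zero_mul] at h2
    exact h0.ne (by exact_mod_cast h2)
  have h4 : (√(1 + u ^ 2) : ℂ) ≠ 0 := by
    exact_mod_cast (Real.sqrt_pos.2 h0).ne'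
  have h5 : (√(1 + u ^ 2) : ℂ) ^ 2 = ((1 + u ^ 2 : ℝ) : ℂ) := by exact_mod_cast h1
  push_cast at h2 h5 ⊢
  field_simp
  rw [h5, ← h2]

/-- Modulus of the characteristic function of `G * c none + ∑ j, c (some j) * E j`. -/
noncomputable def charModulus {n : ℕ} (c : Option (Fin n) → ℝ) (t : ℝ) : ℝ :=
  Real.exp (-((t * c none) ^ 2 / 2)) * ∏ j, (√(1 + (t * c (some j)) ^ 2))⁻¹

lemma integral_cexp_affineForm {n : ℕ} (a : ℝ) (c : Option (Fin n) → ℝ) (t : ℝ) :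
    ∫ ω, Complex.exp ((t * affineForm a c ω : ℝ) * Complex.I) ∂(gaussExp n) =
      charModulus c t *
        Complex.exp ((t * a + ∑ j, Real.arctan (t * c (some j)) : ℝ) * Complex.I) := by
  have e : ∀ ω : Option (Fin n) → ℝ, Complex.exp ((t * affineForm a c ω : ℝ) * Complex.I) =
      Complex.exp ((t * a : ℝ) * Complex.I) *
        ∏ i, Complex.exp (((t * c i : ℝ) : ℂ) * (ω i : ℝ) * Complex.I) := fun ω => by
    rw [← Complex.exp_sum, ← Complex.exp_add, affineForm]
    congr 1
    push_cast
    rw [mul_add, Finset.mul_sum, add_mul, Finset.sum_mul]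
    congr 1
    exact Finset.sum_congr rfl fun i _ => by ring
  simp only [e]
  rw [integral_const_mul, gaussExp, integral_fintype_prod_eq_prod
    (f := fun i y => Complex.exp (((t * c i : ℝ) : ℂ) * (y : ℝ) * Complex.I))]
  simp only [← charFun_apply_real, Fintype.prod_option, gaussExpLaw, charFun_gaussianReal,
    charFun_expMeasure_eq_polar, Finset.prod_mul_distrib, ← Complex.exp_sum]
  rw [charModulus]
  push_cast
  rw [add_mul, Complex.exp_add, ← Finset.sum_mul]
  simp only [mul_zero, zero_mul, zero_sub, one_mul]
  ring

lemma integral_sin_affineForm {n : ℕ} (a : ℝ) (c : Option (Fin n) → ℝ) (t : ℝ) :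
    ∫ ω, Real.sin (t * affineForm a c ω) ∂(gaussExp n) =
      charModulus c t * Real.sin (t * a + ∑ j, Real.arctan (t * c (some j))) := by
  have hX : Continuous fun ω => affineForm a c ω :=
    (by fun_prop : PolyGrowth fun ω => affineForm a c ω).continuous
  have hi : Integrable (fun ω => Complex.exp ((t * affineForm a c ω : ℝ) * Complex.I))
      (gaussExp n) := by
    refine Integrable.of_bound (C := 1) (by fun_prop) (Eventually.of_forall fun ω => ?_)
    rw [Complex.norm_exp_ofReal_mul_I]
  have h := integral_im hi
  simp only [integral_cexp_affineForm, RCLike.im_to_complex, Complex.im_ofReal_mul,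
    Complex.exp_ofReal_mul_I_im] at h
  exact h

/-! ### Positive skewness of centred sums -/

lemma integral_affineForm_mul {n : ℕ} (a : ℝ) (c : Option (Fin n) → ℝ) {F : ℝ → ℝ}
    (hF : PolyGrowth F) :
    ∫ ω, affineForm a c ω * F (affineForm a c ω) ∂(gaussExp n) =
      (a + ∑ j, c (some j)) * ∫ ω, F (affineForm a c ω) ∂(gaussExp n) +
        c none * ∫ ω, ω none * F (affineForm a c ω) ∂(gaussExp n) +
        ∑ j, c (some j) * ∫ ω, (ω (some j) - 1) * F (affineForm a c ω) ∂(gaussExp n) := by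
  have hi : ∀ {K : (Option (Fin n) → ℝ) → ℝ}, PolyGrowth K → Integrable K (gaussExp n) :=
    fun hK => hK.integrable (hasAllMoments_gaussExp n)
  simp only [← integral_const_mul]
  rw [← integral_finsetSum _ fun j _ => hi (by fun_prop), ← integral_add (hi (by fun_prop))
    (hi (by fun_prop)), ← integral_add (hi (by fun_prop)) (hi (by fun_prop))]
  congr 1
  ext ω
  simp only [← mul_assoc, ← Finset.sum_mul, ← add_mul]
  congr 1
  simp only [mul_sub, mul_one, Finset.sum_sub_distrib]
  rw [affineForm, Fintype.sum_option]
  ring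

lemma integral_apply_none (n : ℕ) : ∫ ω, ω none ∂(gaussExp n) = 0 := by
  simpa using integral_none_mul (n := n) 0 0 (F := fun _ => 1) (F' := fun _ => 0)
    (PolyGrowth.const _) (PolyGrowth.const _) fun t => hasDerivAt_const t _

lemma integral_apply_some_sub_one {n : ℕ} (j : Fin n) :
    ∫ ω, (ω (some j) - 1) ∂(gaussExp n) = 0 := by
  simpa using integral_some_sub_one_mul (n := n) 0 0 j (F := fun _ => 1) (F' := fun _ => 0)
    (PolyGrowth.const _) (PolyGrowth.const _) fun t => hasDerivAt_const t _

lemma integral_apply_some {n : ℕ} (j : Fin n) : ∫ ω, ω (some j) ∂(gaussExp n) = 1 := by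
  have h := integral_apply_some_sub_one j
  have hi : Integrable (fun ω : Option (Fin n) → ℝ => ω (some j)) (gaussExp n) :=
    PolyGrowth.integrable (by fun_prop) (hasAllMoments_gaussExp n)
  rw [integral_sub hi (integrable_const _)] at h
  simpa [sub_eq_zero] using h

lemma integral_affineForm {n : ℕ} (a : ℝ) (c : Option (Fin n) → ℝ) :
    ∫ ω, affineForm a c ω ∂(gaussExp n) = a + ∑ j, c (some j) := by
  simpa [integral_apply_none, integral_apply_some_sub_one] using
    integral_affineForm_mul a c (F := fun _ => 1) (PolyGrowth.const _)

/-- Writing the signed power as a mixture of `x ↦ t * x - sin (t * x)` turns the expectation into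
an integral of `charModulus c t * t ^ (-ρ - 2) * sin (Θ t)`, where `Θ` is minus the argument of
the characteristic function and `Θ'` is increasing, so `integral_mul_sin_pos` applies. -/
lemma integral_mul_abs_rpow_affineForm_pos_of_lt_two {n : ℕ} {c : Option (Fin n) → ℝ}
    (hc : ∀ j, 0 ≤ c (some j)) (hc' : ∃ j, 0 < c (some j)) {ρ : ℝ} (h0 : 0 < ρ) (h2 : ρ < 2) :
    0 < ∫ ω, affineForm (-∑ j, c (some j)) c ω * |affineForm (-∑ j, c (some j)) c ω| ^ ρ
      ∂(gaussExp n) := by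
  set a := -∑ j, c (some j) with ha
  set κ := ∫ t in Set.Ioi 0, (t - Real.sin t) * t ^ (-ρ - 2) with hκ
  have hκ0 : 0 < κ := integral_sub_sin_mul_rpow_pos h0 h2
  have hXP : PolyGrowth fun ω => affineForm a c ω := by fun_prop
  have hX : Continuous fun ω => affineForm a c ω := hXP.continuous
  -- exchange the integrals
  have hprod : Integrable (fun x : (Option (Fin n) → ℝ) × ℝ =>
      (x.2 * affineForm a c x.1 - Real.sin (x.2 * affineForm a c x.1)) * x.2 ^ (-ρ - 2))
      ((gaussExp n).prod (volume.restrict (Set.Ioi 0))) := by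
    have hm : Measurable fun x : (Option (Fin n) → ℝ) × ℝ =>
        (x.2 * affineForm a c x.1 - Real.sin (x.2 * affineForm a c x.1)) * x.2 ^ (-ρ - 2) := by
      have := hX.measurable
      fun_prop
    rw [integrable_prod_iff hm.aestronglyMeasurable]
    refine ⟨Eventually.of_forall fun ω =>
      (integrableOn_and_integral_sub_sin h0 h2 (affineForm a c ω)).1, ?_⟩
    have e : ∀ ω, ∫ t in Set.Ioi 0, ‖(t * affineForm a c ω - Real.sin (t * affineForm a c ω)) *
        t ^ (-ρ - 2)‖ = κ * (|affineForm a c ω| * |affineForm a c ω| ^ ρ) := fun ω => by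
      have h3 := (integrableOn_and_integral_sub_sin h0 h2 |affineForm a c ω|).2
      rw [abs_abs] at h3
      rw [hκ, ← h3]
      refine setIntegral_congr_fun measurableSet_Ioi fun t ht => ?_
      have ht : 0 < t := ht
      rw [norm_mul, Real.norm_of_nonneg (Real.rpow_nonneg ht.le _), Real.norm_eq_abs]
      congr 1
      rcases abs_cases (affineForm a c ω) with ⟨h5, h6⟩ | ⟨h5, h6⟩ <;> rw [h5]
      · exact abs_of_nonneg (sub_sin_nonneg (by positivity))
      · rw [mul_neg, Real.sin_neg, ← abs_neg]
        have := sub_sin_nonneg (t := t * -affineForm a c ω) (mul_nonneg ht.le (by linarith))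
        rw [mul_neg, Real.sin_neg] at this
        rw [abs_of_nonneg (by linarith)]; ring
    simp only [e]
    exact PolyGrowth.integrable (PolyGrowth.mul (by fun_prop) (PolyGrowth.mul (by fun_prop)
      (PolyGrowth.abs_rpow (by fun_prop) h0.le))) (hasAllMoments_gaussExp n)
  set Θ : ℝ → ℝ := fun t => ∑ j, (t * c (some j) - Real.arctan (t * c (some j))) with hΘ
  have hsin : ∀ t ∈ Set.Ioi (0 : ℝ), ∫ ω, (t * affineForm a c ω - Real.sin (t * affineForm a c ω)) *
      t ^ (-ρ - 2) ∂(gaussExp n) = charModulus c t * t ^ (-ρ - 2) * Real.sin (Θ t) := fun t ht => by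
    have hi : Integrable (fun ω => Real.sin (t * affineForm a c ω)) (gaussExp n) := by
      refine Integrable.of_bound (C := 1) (by fun_prop) (Eventually.of_forall fun ω => ?_)
      exact Real.abs_sin_le_one _
    have e : t * a + ∑ j, Real.arctan (t * c (some j)) = -Θ t := by
      rw [hΘ, ha]
      simp only [Finset.sum_sub_distrib, mul_neg, Finset.mul_sum]
      ring
    rw [integral_mul_const, integral_sub ((hXP.integrable (hasAllMoments_gaussExp n)).const_mul t)
      hi, integral_const_mul, integral_affineForm, integral_sin_affineForm, e, ha, Real.sin_neg]
    ring
  have hI : IntegrableOn (fun t => charModulus c t * t ^ (-ρ - 2) * Real.sin (Θ t)) (Set.Ioi 0) :=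
    IntegrableOn.congr_fun (hprod.integral_prod_right) hsin measurableSet_Ioi
  have hmain : κ * ∫ ω, affineForm a c ω * |affineForm a c ω| ^ ρ ∂(gaussExp n) =
      ∫ t in Set.Ioi 0, charModulus c t * t ^ (-ρ - 2) * Real.sin (Θ t) := by
    rw [← integral_const_mul, ← setIntegral_congr_fun measurableSet_Ioi hsin,
      ← integral_integral_swap hprod]
    congr 1
    ext ω
    exact (integrableOn_and_integral_sub_sin h0 h2 (affineForm a c ω)).2.symm
  refine pos_of_mul_pos_right ?_ hκ0.le
  rw [hmain]
  -- write the integrand as a decreasing weight against `Θ' * sin Θ`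
  obtain ⟨j₀, hj₀⟩ := hc'
  set Θ' : ℝ → ℝ := fun t => ∑ j, c (some j) * (1 - (1 + (t * c (some j)) ^ 2)⁻¹) with hΘ'
  have hone : ∀ (t : ℝ) j, 1 ≤ 1 + (t * c (some j)) ^ 2 := fun t j => by
    nlinarith [sq_nonneg (t * c (some j))]
  have hΘ'0 : ∀ t, 0 < t → 0 < Θ' t := fun t ht => by
    refine Finset.sum_pos' (fun j _ =>
        mul_nonneg (hc j) (sub_nonneg.2 (inv_le_one_of_one_le₀ (hone t j))))
      ⟨j₀, Finset.mem_univ _, mul_pos hj₀ (sub_pos.2 (inv_lt_one_of_one_lt₀ ?_))⟩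
    have : 0 < (t * c (some j₀)) ^ 2 := by positivity
    linarith
  have hΘ'mono : ∀ t t', 0 < t → t < t' → Θ' t ≤ Θ' t' := fun t t' ht htt' => by
    refine Finset.sum_le_sum fun j _ => mul_le_mul_of_nonneg_left ?_ (hc j)
    have := hc j
    gcongr
  have hRpos : ∀ t, 0 < charModulus c t := fun t => by
    refine mul_pos (Real.exp_pos _) (Finset.prod_pos fun j _ => inv_pos.2 (Real.sqrt_pos.2 ?_))
    linarith [hone t j]
  have hRanti : ∀ t t', 0 < t → t < t' → charModulus c t' ≤ charModulus c t :=
      fun t t' ht htt' => by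
    unfold charModulus
    refine mul_le_mul ?_ (Finset.prod_le_prod (fun j _ => by positivity) fun j _ => ?_)
      (Finset.prod_nonneg fun j _ => by positivity) (Real.exp_pos _).le
    · rw [Real.exp_le_exp, neg_le_neg_iff, mul_pow, mul_pow]
      gcongr
    · have := hc j
      have := hone t j
      gcongr
  have key := integral_mul_sin_pos (Θ := Θ) (Θ' := Θ')
    (W := fun t => charModulus c t * t ^ (-ρ - 2) / Θ' t) ?_ ?_ hΘ'0 (by simp [hΘ]) ?_ ?_ ?_ ?_ ?_
  · refine key.trans_eq (setIntegral_congr_fun measurableSet_Ioi fun t ht => ?_)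
    have := (hΘ'0 t ht).ne'
    field_simp
  · intro t
    refine HasDerivAt.fun_sum fun j _ => ?_
    have h1 : HasDerivAt (fun t => t * c (some j)) (c (some j)) t := by
      simpa using (hasDerivAt_id t).mul_const (c (some j))
    refine (h1.sub h1.arctan).congr_deriv ?_
    ring
  · refine continuous_finsetSum _ fun j _ => ?_
    have : ∀ t : ℝ, 1 + (t * c (some j)) ^ 2 ≠ 0 := fun t => by linarith [hone t j]
    fun_prop (disch := exact this)
  · have h1 : Tendsto (fun t : ℝ => t * c (some j₀) - Real.pi / 2) atTop atTop :=
      tendsto_atTop_add_const_right _ _ (tendsto_id.atTop_mul_const hj₀)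
    refine tendsto_atTop_mono' _ ?_ h1
    filter_upwards [eventually_ge_atTop 0] with t ht
    have h3 : ∀ j, 0 ≤ t * c (some j) - Real.arctan (t * c (some j)) := fun j => by
      have h4 := Real.le_tan (Real.arctan_nonneg.2 (mul_nonneg ht (hc j)))
        (Real.arctan_lt_pi_div_two _)
      rw [Real.tan_arctan] at h4
      linarith
    have := Finset.single_le_sum (fun j _ => h3 j) (Finset.mem_univ j₀)
    linarith [Real.arctan_lt_pi_div_two (t * c (some j₀))]
  · intro t ht t' ht' htt'
    have ht : 0 < t := ht
    have ht' : 0 < t' := ht'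
    have h3 : t' ^ (-ρ - 2) < t ^ (-ρ - 2) := Real.rpow_lt_rpow_of_neg ht htt' (by linarith)
    refine div_lt_div₀ ?_ (hΘ'mono t t' ht htt') ?_ (hΘ'0 t ht)
    · exact mul_lt_mul_of_le_of_lt_of_nonneg_of_pos (hRanti t t' ht htt') h3
        (Real.rpow_nonneg ht'.le _) (hRpos t)
    · exact mul_nonneg (hRpos t).le (Real.rpow_nonneg ht.le _)
  · intro t ht
    exact div_nonneg (mul_nonneg (hRpos t).le (Real.rpow_nonneg ht.le _)) (hΘ'0 t ht).le
  · intro t ht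
    have h3 : ∀ j (t : ℝ), 1 + (t * c (some j)) ^ 2 ≠ 0 := fun j t => by linarith [hone t j]
    have h4 : ∀ j (t : ℝ), √(1 + (t * c (some j)) ^ 2) ≠ 0 := fun j t =>
      (Real.sqrt_pos.2 (by linarith [hone t j])).ne'
    refine DifferentiableAt.div (DifferentiableAt.mul ?_ ?_) ?_ (hΘ'0 t ht).ne'
    · unfold charModulus
      refine DifferentiableAt.mul (by fun_prop) (DifferentiableAt.fun_finsetProd fun j _ => ?_)
      exact DifferentiableAt.inv (DifferentiableAt.sqrt (by fun_prop) (h3 j t)) (h4 j t)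
    · exact (Real.hasDerivAt_rpow_const (Or.inl ht.ne')).differentiableAt
    · refine DifferentiableAt.fun_sum fun j _ => ?_
      exact ((differentiableAt_const _).sub (DifferentiableAt.inv
        (h := fun t => 1 + (t * c (some j)) ^ 2) (by fun_prop) (h3 j t))).const_mul _
  · refine hI.congr_fun (fun t ht => ?_) measurableSet_Ioi
    have := (hΘ'0 t ht).ne'
    field_simp

/-- Centred sums with nonnegative coefficients on the exponential variables are positively skewed
with respect to all signed powers of exponent larger than `1`. Two integrations by parts lower
the exponent by `2`, down to the range covered by the Fourier representation. -/
lemma integral_mul_abs_rpow_affineForm_pos {n : ℕ} {c : Option (Fin n) → ℝ}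
    (hc : ∀ j, 0 ≤ c (some j)) (hc' : ∃ j, 0 < c (some j)) {ρ : ℝ} (h0 : 0 < ρ) :
    0 < ∫ ω, affineForm (-∑ j, c (some j)) c ω * |affineForm (-∑ j, c (some j)) c ω| ^ ρ
      ∂(gaussExp n) := by
  obtain ⟨k, hk⟩ : ∃ k : ℕ, ρ < 2 * (k + 1) := by
    obtain ⟨k, hk⟩ := exists_nat_gt ρ
    exact ⟨k, by linarith⟩
  induction k generalizing ρ with
  | zero => exact integral_mul_abs_rpow_affineForm_pos_of_lt_two hc hc' h0 (by simpa using hk)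
  | succ k ih =>
    rcases lt_or_ge ρ 2 with h2 | h2
    · exact integral_mul_abs_rpow_affineForm_pos_of_lt_two hc hc' h0 h2
    set a := -∑ j, c (some j) with ha
    obtain ⟨j₀, hj₀⟩ := hc'
    have hi : ∀ {K : (Option (Fin n) → ℝ) → ℝ}, PolyGrowth K → Integrable K (gaussExp n) :=
      fun hK => hK.integrable (hasAllMoments_gaussExp n)
    have hF : PolyGrowth fun t : ℝ => |t| ^ ρ := PolyGrowth.abs_rpow PolyGrowth.id h0.le
    have hσ : PolyGrowth fun t : ℝ => |t| ^ (ρ - 2) :=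
      PolyGrowth.abs_rpow PolyGrowth.id (by linarith)
    have hF' : PolyGrowth fun t : ℝ => t * |t| ^ (ρ - 2) := by fun_prop
    have hFX : PolyGrowth fun ω => affineForm a c ω * |affineForm a c ω| ^ (ρ - 2) :=
      hF'.comp (by fun_prop)
    have hd : ∀ t : ℝ, HasDerivAt (fun t => |t| ^ ρ) (ρ * (t * |t| ^ (ρ - 2))) t := fun t =>
      (hasDerivAt_abs_rpow t (by linarith)).congr_deriv (by ring)
    set A := ∫ ω, affineForm a c ω * |affineForm a c ω| ^ (ρ - 2) ∂(gaussExp n) with hA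
    set B : Fin n → ℝ := fun j => ∫ ω, (ω (some j) - 1) *
      (affineForm a c ω * |affineForm a c ω| ^ (ρ - 2)) ∂(gaussExp n) with hB
    have hBeq : ∀ j, B j = c (some j) * ((ρ - 1) *
        ∫ ω, ω (some j) * |affineForm a c ω| ^ (ρ - 2) ∂(gaussExp n)) := fun j => by
      rw [hB, ← integral_const_mul]
      have := integral_some_sub_one_mul a c j hF' (F' := fun t => (ρ - 1) * |t| ^ (ρ - 2))
        (by fun_prop) fun t =>
          (hasDerivAt_mul_abs_rpow (ρ := ρ - 2) (by linarith) t).congr_deriv (by ring)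
      simp only [this, mul_left_comm]
    have hint0 : ∀ j, 0 ≤ ∫ ω, ω (some j) * |affineForm a c ω| ^ (ρ - 2) ∂(gaussExp n) :=
        fun j => by
      rw [integral_some_mul a c j hσ]
      exact integral_nonneg fun y => integral_nonneg fun ω => by positivity
    have hB0 : ∀ j, 0 ≤ B j := fun j => by
      rw [hBeq]
      exact mul_nonneg (hc j) (mul_nonneg (by linarith) (hint0 j))
    have hAB : 0 ≤ A ∧ 0 < A + B j₀ := by
      rcases h2.eq_or_lt with rfl | h2
      · have h3 : A = 0 := by simp [hA, integral_affineForm, ha]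
        have h4 : 0 < B j₀ := by
          rw [hBeq]
          simp [integral_apply_some, hj₀]
        exact ⟨h3.ge, by linarith⟩
      · have h3 : 0 < A := ih (ρ := ρ - 2) (by linarith) (by push_cast at hk; linarith)
        exact ⟨h3.le, add_pos_of_pos_of_nonneg h3 (hB0 _)⟩
    rw [integral_affineForm_mul a c hF, integral_none_mul a c hF (by fun_prop) hd,
      integral_const_mul, ← hA]
    have e : ∀ j, ∫ ω, (ω (some j) - 1) * |affineForm a c ω| ^ ρ ∂(gaussExp n) =
        c (some j) * (ρ * (A + B j)) := fun j => by
      rw [integral_some_sub_one_mul a c j hF (by fun_prop) hd, hA, hB,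
        ← integral_add (hi hFX) (hi (PolyGrowth.mul (by fun_prop) hFX)),
        ← integral_const_mul ρ]
      congr 2
      ext ω
      ring
    simp only [e]
    have h5 : 0 < ∑ j, c (some j) * (c (some j) * (ρ * (A + B j))) := by
      refine Finset.sum_pos' (fun j _ => ?_) ⟨j₀, Finset.mem_univ _, ?_⟩
      · have := hB0 j
        have := hc j
        have := hAB.1
        positivity
      · have := hAB.2
        positivity
    have h6 : 0 ≤ c none * (c none * (ρ * A)) := by
      have := hAB.1
      rw [← mul_assoc]
      exact mul_nonneg (mul_self_nonneg _) (by positivity)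
    have h7 : a + ∑ j, c (some j) = 0 := by simp [ha]
    rw [h7]
    linarith

/-! ### Minimisers of the `p`-th moment under a variance constraint -/

/-- The `p`-th absolute moment of `a + c none * G + ∑ j, c (some j) * E j`. -/
noncomputable def absMoment {n : ℕ} (p a : ℝ) (c : Option (Fin n) → ℝ) : ℝ :=
  ∫ ω, |affineForm a c ω| ^ p ∂(gaussExp n)

variable {n : ℕ} {p : ℝ}

lemma absMoment_nonneg (a : ℝ) (c : Option (Fin n) → ℝ) : 0 ≤ absMoment p a c :=
  integral_nonneg fun ω => by positivity

lemma affineForm_smul (r a : ℝ) (c ω : Option (Fin n) → ℝ) :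
    affineForm (r * a) (fun i => r * c i) ω = r * affineForm a c ω := by
  simp only [affineForm, mul_add, Finset.mul_sum, mul_assoc]

lemma absMoment_smul {r : ℝ} (hr : 0 ≤ r) (a : ℝ) (c : Option (Fin n) → ℝ) :
    absMoment p (r * a) (fun i => r * c i) = r ^ p * absMoment p a c := by
  simp only [absMoment, affineForm_smul, abs_mul, abs_of_nonneg hr,
    Real.mul_rpow hr (abs_nonneg _), integral_const_mul]

lemma absMoment_neg (a : ℝ) (c : Option (Fin n) → ℝ) :
    absMoment p (-a) (fun i => -c i) = absMoment p a c := by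
  have := fun ω => affineForm_smul (-1) a c ω
  simp only [neg_one_mul] at this
  simp only [absMoment, this, abs_neg]

lemma polyGrowth_absMoment (hp : 0 ≤ p) :
    PolyGrowth fun x : ℝ × (Option (Fin n) → ℝ) => absMoment p x.1 x.2 :=
  PolyGrowth.integral_right
    (F := fun x : (ℝ × (Option (Fin n) → ℝ)) × (Option (Fin n) → ℝ) =>
      |affineForm x.1.1 x.1.2 x.2| ^ p)
    (PolyGrowth.abs_rpow (by fun_prop) hp) (hasAllMoments_gaussExp n)

/-- Jensen's inequality. -/
lemma abs_mean_rpow_le_absMoment (hp : 1 ≤ p) (a : ℝ) (c : Option (Fin n) → ℝ) :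
    |a + ∑ j, c (some j)| ^ p ≤ absMoment p a c := by
  have hX : PolyGrowth fun ω => |affineForm a c ω| := by fun_prop
  have h1 : (∫ ω, |affineForm a c ω| ∂(gaussExp n)) ^ p ≤ absMoment p a c :=
    (convexOn_rpow hp).map_integral_le (μ := gaussExp n) (f := fun ω => |affineForm a c ω|)
      (Real.continuous_rpow_const (by linarith)).continuousOn isClosed_Ici
      (Eventually.of_forall fun ω => Set.mem_Ici.2 (abs_nonneg _))
      (hX.integrable (hasAllMoments_gaussExp n))
      ((PolyGrowth.abs_rpow (by fun_prop) (by linarith)).integrable (hasAllMoments_gaussExp n))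
  refine le_trans ?_ h1
  rw [← integral_affineForm]
  gcongr
  exact abs_integral_le_integral_abs

/-- Existence of a minimiser: the coefficients range over a sphere, and large drifts are excluded
by Jensen's inequality. -/
lemma exists_absMoment_le (n : ℕ) (hp : 1 ≤ p) : ∃ (a : ℝ) (c : Option (Fin n) → ℝ),
    ∑ i, c i ^ 2 = 1 ∧ ∀ (a' : ℝ) (c' : Option (Fin n) → ℝ), ∑ i, c' i ^ 2 = 1 →
      absMoment p a c ≤ absMoment p a' c' := by
  set c₀ : Option (Fin n) → ℝ := Pi.single none 1 with hc₀
  have hc₀s : ∑ i, c₀ i ^ 2 = 1 := by simp [hc₀, Fintype.sum_option]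
  set M := absMoment p 0 c₀
  have hM : 0 ≤ M := absMoment_nonneg _ _
  have hone : ∀ c : Option (Fin n) → ℝ, ∑ i, c i ^ 2 = 1 → ∀ i, |c i| ≤ 1 := fun c hc i => by
    rw [← sq_le_one_iff_abs_le_one, ← hc]
    exact Finset.single_le_sum (f := fun i => c i ^ 2) (fun i _ => sq_nonneg _) (Finset.mem_univ i)
  set K : Set (ℝ × (Option (Fin n) → ℝ)) :=
    Set.Icc (-(n + M + 1)) (n + M + 1) ×ˢ {c | ∑ i, c i ^ 2 = 1} with hK
  have hKc : IsCompact K := by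
    refine isCompact_Icc.prod (Metric.isCompact_of_isClosed_isBounded ?_ ?_)
    · exact isClosed_eq (by fun_prop) continuous_const
    · refine (Metric.isBounded_closedBall (x := (0 : Option (Fin n) → ℝ)) (r := 1)).subset
        fun c hc => ?_
      rw [mem_closedBall_zero_iff, pi_norm_le_iff_of_nonneg zero_le_one]
      exact hone c hc
  have hc₀K : (0, c₀) ∈ K := ⟨⟨by linarith [(Nat.cast_nonneg n : (0:ℝ) ≤ n)],
    by linarith [(Nat.cast_nonneg n : (0:ℝ) ≤ n)]⟩, hc₀s⟩
  obtain ⟨⟨a, c⟩, hac, hmin⟩ := hKc.exists_isMinOn ⟨_, hc₀K⟩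
    (polyGrowth_absMoment (n := n) (p := p) (by linarith)).continuous.continuousOn
  refine ⟨a, c, hac.2, fun a' c' hc' => ?_⟩
  by_cases ha' : a' ∈ Set.Icc (-(n + M + 1)) (n + M + 1)
  · exact hmin (⟨ha', hc'⟩ : (a', c') ∈ K)
  · -- a large drift is never better than the reference point `(0, c₀)`
    refine (hmin hc₀K).trans (le_trans ?_ (abs_mean_rpow_le_absMoment hp a' c'))
    have h1 : n + M + 1 < |a'| := by
      by_contra! h
      exact ha' (abs_le.1 h)
    have h2 : |∑ j, c' (some j)| ≤ n := by
      refine (Finset.abs_sum_le_sum_abs _ _).trans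
        ((Finset.sum_le_sum fun j _ => hone c' hc' _).trans ?_)
      simp
    have h3 : M + 1 ≤ |a' + ∑ j, c' (some j)| := by
      have := abs_sub_abs_le_abs_sub a' (-∑ j, c' (some j))
      rw [abs_neg, sub_neg_eq_add] at this
      linarith
    calc M ≤ |a' + ∑ j, c' (some j)| ^ (1 : ℝ) := by rw [Real.rpow_one]; linarith
      _ ≤ _ := Real.rpow_le_rpow_of_exponent_le (by linarith) hp

/-- The constraint in homogeneous form. -/
lemma mul_rpow_le_absMoment {m : ℝ} (hp : 1 ≤ p)
    (hm : ∀ (a : ℝ) (c : Option (Fin n) → ℝ), ∑ i, c i ^ 2 = 1 → m ≤ absMoment p a c)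
    (a : ℝ) (c : Option (Fin n) → ℝ) : m * (∑ i, c i ^ 2) ^ (p / 2) ≤ absMoment p a c := by
  set b := ∑ i, c i ^ 2 with hb
  have hb0 : 0 ≤ b := Finset.sum_nonneg fun i _ => sq_nonneg _
  rcases hb0.eq_or_lt with h | hb0
  · rw [← h, Real.zero_rpow (by linarith), mul_zero]
    exact absMoment_nonneg _ _
  · have hs : 0 < √b := Real.sqrt_pos.2 hb0
    have h1 := hm ((√b)⁻¹ * a) (fun i => (√b)⁻¹ * c i) (by
      simp only [mul_pow, ← Finset.mul_sum, ← hb, inv_pow, Real.sq_sqrt hb0.le]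
      exact inv_mul_cancel₀ hb0.ne')
    rw [absMoment_smul (by positivity)] at h1
    have h2 : b ^ (p / 2) = √b ^ p := by
      rw [Real.sqrt_eq_rpow, ← Real.rpow_mul hb0.le]; congr 1; ring
    have h3 : √b ^ p * (√b)⁻¹ ^ p = 1 := by
      rw [← Real.mul_rpow hs.le (by positivity), mul_inv_cancel₀ hs.ne', Real.one_rpow]
    calc m * b ^ (p / 2) ≤ ((√b)⁻¹ ^ p * absMoment p a c) * b ^ (p / 2) := by gcongr
      _ = (√b ^ p * (√b)⁻¹ ^ p) * absMoment p a c := by rw [h2]; ring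
      _ = _ := by rw [h3, one_mul]

lemma hasDerivAt_abs_rpow_two_lt (hp : 2 < p) (t : ℝ) :
    HasDerivAt (fun t : ℝ => |t| ^ p) (p * (t * |t| ^ (p - 2))) t :=
  (hasDerivAt_abs_rpow t (by linarith)).congr_deriv (by ring)

lemma hasDerivAt_mul_abs_rpow_two_lt (hp : 2 < p) (t : ℝ) :
    HasDerivAt (fun t : ℝ => t * |t| ^ (p - 2)) ((p - 1) * |t| ^ (p - 2)) t :=
  (hasDerivAt_mul_abs_rpow (by linarith) t).congr_deriv (by ring)

section Critical

variable {m a : ℝ} {c : Option (Fin n) → ℝ}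

/-- Stationarity in the drift. -/
lemma integral_mul_abs_rpow_eq_zero_of_min (hp : 2 < p) (hc : ∑ i, c i ^ 2 = 1)
    (hm : absMoment p a c = m)
    (hmin : ∀ (a' : ℝ) (c' : Option (Fin n) → ℝ),
      m * (∑ i, c' i ^ 2) ^ (p / 2) ≤ absMoment p a' c') :
    ∫ ω, affineForm a c ω * |affineForm a c ω| ^ (p - 2) ∂(gaussExp n) = 0 := by
  have hF : PolyGrowth fun t : ℝ => |t| ^ p := PolyGrowth.abs_rpow PolyGrowth.id (by linarith)
  have hF' : PolyGrowth fun t : ℝ => t * |t| ^ (p - 2) := PolyGrowth.mul_abs_rpow (by linarith)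
  have h := hasDerivAt_integral_affineForm_const a c hF (by fun_prop)
    (hasDerivAt_abs_rpow_two_lt hp)
  have hloc : IsLocalMin (fun ε => ∫ ω, |affineForm (a + ε) c ω| ^ p ∂(gaussExp n)) 0 := by
    refine Eventually.of_forall fun ε => ?_
    have := hmin (a + ε) c
    rw [hc, Real.one_rpow, mul_one, ← hm] at this
    simpa [absMoment] using this
  have h1 := hloc.hasDerivAt_eq_zero h
  rw [integral_const_mul] at h1
  exact (mul_eq_zero.1 h1).resolve_left (by linarith)

/-- Stationarity in the coefficients, with Lagrange multiplier `m`. -/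
lemma integral_apply_mul_eq_of_min (hp : 2 < p) (hc : ∑ i, c i ^ 2 = 1)
    (hm : absMoment p a c = m)
    (hmin : ∀ (a' : ℝ) (c' : Option (Fin n) → ℝ),
      m * (∑ i, c' i ^ 2) ^ (p / 2) ≤ absMoment p a' c') (i : Option (Fin n)) :
    ∫ ω, ω i * (affineForm a c ω * |affineForm a c ω| ^ (p - 2)) ∂(gaussExp n) = m * c i := by
  have hF : PolyGrowth fun t : ℝ => |t| ^ p := PolyGrowth.abs_rpow PolyGrowth.id (by linarith)
  have hF' : PolyGrowth fun t : ℝ => t * |t| ^ (p - 2) := PolyGrowth.mul_abs_rpow (by linarith)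
  have h := hasDerivAt_integral_affineForm_coeff a c i hF (by fun_prop)
    (hasDerivAt_abs_rpow_two_lt hp)
  have hsum : ∀ ε, ∑ k, Function.update c i (c i + ε) k ^ 2 = 1 + (2 * c i * ε + ε ^ 2) :=
      fun ε => by
    rw [← hc]
    simp only [← Finset.add_sum_erase _ _ (Finset.mem_univ i), Function.update_self]
    have : ∑ k ∈ Finset.univ.erase i, Function.update c i (c i + ε) k ^ 2 =
        ∑ k ∈ Finset.univ.erase i, c k ^ 2 :=
      Finset.sum_congr rfl fun k hk => by simp [Finset.ne_of_mem_erase hk]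
    rw [this]; ring
  have hb : HasDerivAt (fun ε : ℝ => m * (1 + (2 * c i * ε + ε ^ 2)) ^ (p / 2))
      (m * (p * c i)) 0 := by
    have h1 : HasDerivAt (fun ε : ℝ => 1 + (2 * c i * ε + ε ^ 2)) (2 * c i) 0 := by
      simpa using (((hasDerivAt_id (0:ℝ)).const_mul (2 * c i)).add
        ((hasDerivAt_id (0:ℝ)).pow 2)).const_add 1
    refine ((h1.rpow_const (p := p / 2) (Or.inl (by simp))).const_mul m).congr_deriv ?_
    simp only [mul_zero, ne_eq, OfNat.ofNat_ne_zero, not_false_eq_true, zero_pow, add_zero,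
      Real.one_rpow, mul_one]
    ring
  have hloc : IsLocalMin (fun ε => (∫ ω, |affineForm a (Function.update c i (c i + ε)) ω| ^ p
      ∂(gaussExp n)) - m * (1 + (2 * c i * ε + ε ^ 2)) ^ (p / 2)) 0 := by
    refine Eventually.of_forall fun ε => ?_
    have := hmin a (Function.update c i (c i + ε))
    rw [hsum] at this
    simp only [absMoment] at this hm
    simp [hm]
    linarith
  have h1 := hloc.hasDerivAt_eq_zero (h.sub hb)
  have e : ∀ ω : Option (Fin n) → ℝ, ω i * (p * (affineForm a c ω * |affineForm a c ω| ^ (p - 2))) =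
      p * (ω i * (affineForm a c ω * |affineForm a c ω| ^ (p - 2))) := fun ω => by ring
  simp only [e] at h1
  rw [integral_const_mul] at h1
  have hp0 : p ≠ 0 := by linarith
  apply mul_left_cancel₀ hp0
  linarith

/-- Transferring variance to the Gaussian variable cannot help. This is a first order
condition in the variance, hence of second order in `c none` when `c none = 0`. -/
lemma le_integral_abs_rpow_of_min (hp : 2 < p) (hc : ∑ i, c i ^ 2 = 1)
    (hm : absMoment p a c = m)
    (hmin : ∀ (a' : ℝ) (c' : Option (Fin n) → ℝ),
      m * (∑ i, c' i ^ 2) ^ (p / 2) ≤ absMoment p a' c') :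
    m ≤ (p - 1) * ∫ ω, |affineForm a c ω| ^ (p - 2) ∂(gaussExp n) := by
  have hF : PolyGrowth fun t : ℝ => |t| ^ p := PolyGrowth.abs_rpow PolyGrowth.id (by linarith)
  have hF' : PolyGrowth fun t : ℝ => t * |t| ^ (p - 2) := PolyGrowth.mul_abs_rpow (by linarith)
  have hF'' : PolyGrowth fun t : ℝ => |t| ^ (p - 2) :=
    PolyGrowth.abs_rpow PolyGrowth.id (by linarith)
  have hm0 : 0 ≤ m := hm ▸ absMoment_nonneg a c
  have stein : ∀ c' : Option (Fin n) → ℝ,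
      ∫ ω, ω none * (affineForm a c' ω * |affineForm a c' ω| ^ (p - 2)) ∂(gaussExp n) =
      c' none * ((p - 1) * ∫ ω, |affineForm a c' ω| ^ (p - 2) ∂(gaussExp n)) := fun c' => by
    rw [integral_none_mul a c' hF' (by fun_prop) (hasDerivAt_mul_abs_rpow_two_lt hp),
      integral_const_mul]
  by_cases h0 : c none = 0
  · -- `p * σ * k σ` is the derivative of the moment along `c none = σ`
    by_contra! hlt
    set k : ℝ → ℝ := fun σ => (p - 1) * ∫ ω, |affineForm a c ω + σ * ω none| ^ (p - 2)
      ∂(gaussExp n) with hk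
    have hkc : Continuous k := by
      refine Continuous.const_mul (PolyGrowth.continuous ?_) _
      exact PolyGrowth.integral_right (F := fun x : ℝ × (Option (Fin n) → ℝ) =>
        |affineForm a c x.2 + x.1 * x.2 none| ^ (p - 2))
        (PolyGrowth.abs_rpow (by fun_prop) (by linarith)) (hasAllMoments_gaussExp n)
    have hk0 : k 0 < m := by simpa [hk] using hlt
    obtain ⟨δ, hδ, hball⟩ := Metric.eventually_nhds_iff.1
      ((hkc.tendsto 0).eventually_lt_const hk0)
    set g : ℝ → ℝ := fun σ => ∫ ω, |affineForm a c ω + σ * ω none| ^ p ∂(gaussExp n) with hg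
    have hupd : ∀ (σ : ℝ) (ω : Option (Fin n) → ℝ),
        affineForm a (Function.update c none σ) ω = affineForm a c ω + σ * ω none := fun σ ω => by
      rw [affineForm_update_coeff, h0, sub_zero]
    have hgd : ∀ σ, HasDerivAt g (p * (σ * k σ)) σ := fun σ => by
      refine (hasDerivAt_integral_comp_add_mul (hasAllMoments_gaussExp n) hF (F' := fun t =>
        p * (t * |t| ^ (p - 2))) (by fun_prop) (hasDerivAt_abs_rpow_two_lt hp)
        (X := affineForm a c) (K := fun ω => ω none) (by fun_prop) (by fun_prop) σ).congr_deriv ?_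
      have h1 := stein (Function.update c none σ)
      simp only [hupd, Function.update_self] at h1
      rw [hk, ← h1, ← integral_const_mul]
      congr 1; ext ω; ring
    have hanti : StrictAntiOn (fun σ => g σ - m * (p / 2) * σ ^ 2) (Set.Icc 0 (δ / 2)) := by
      have hd : ∀ σ, HasDerivAt (fun σ => g σ - m * (p / 2) * σ ^ 2)
          (p * (σ * k σ) - m * p * σ) σ := fun σ => by
        refine ((hgd σ).sub (((hasDerivAt_id' σ).pow 2).const_mul (m * (p / 2)))).congr_deriv ?_
        simp; ring
      refine strictAntiOn_of_deriv_neg (convex_Icc _ _)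
        (fun σ _ => (hd σ).continuousAt.continuousWithinAt) fun σ hσ => ?_
      rw [interior_Icc] at hσ
      rw [(hd σ).deriv]
      have h1 : k σ < m := hball (by
        rw [Real.dist_eq, sub_zero, abs_of_pos hσ.1]; linarith [hσ.2])
      have h2 : 0 < p * σ := mul_pos (by linarith) hσ.1
      nlinarith
    have h1 := hanti ⟨le_rfl, by positivity⟩ (show δ / 2 ∈ Set.Icc 0 (δ / 2) from
      ⟨by positivity, le_rfl⟩) (by positivity)
    have h2 := hmin a (Function.update c none (δ / 2))
    have h3 : ∑ i, Function.update c none (δ / 2) i ^ 2 = 1 + (δ / 2) ^ 2 := by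
      simp only [Fintype.sum_option, h0] at hc ⊢
      simp at hc ⊢
      linarith
    rw [h3] at h2
    have h4 : absMoment p a (Function.update c none (δ / 2)) = g (δ / 2) := by
      simp only [absMoment, hupd, hg]
    have h5 : g 0 = m := by simp [hg, ← hm, absMoment]
    -- Bernoulli's inequality
    have h6 := one_add_mul_self_le_rpow_one_add (s := (δ / 2) ^ 2)
      (by nlinarith [sq_nonneg (δ / 2)]) (p := p / 2) (by linarith)
    have h7 := mul_le_mul_of_nonneg_left h6 hm0
    rw [h4] at h2
    simp only [h5] at h1
    nlinarith
  · have h1 := integral_apply_mul_eq_of_min hp hc hm hmin none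
    rw [stein, mul_comm m] at h1
    exact (mul_left_cancel₀ h0 h1).ge

/-- A minimiser has no exponential part. With `X` the minimising combination and `q = p - 2`,
the stationarity conditions bound `E (E j * |X| ^ q)` by `E |X| ^ q` whenever `c (some j) ≠ 0`;
if `E |X + t| ^ q > E |X| ^ q` for negative `t`, this excludes negative coefficients. Then the
skewness inequality makes the mean of `X` negative, and expanding `E (X * |X| ^ q) = 0` along
the variables yields a sum of nonpositive terms, one of which is negative. -/
lemma coeff_some_eq_zero_of_min (hp : 2 < p) (hc : ∑ i, c i ^ 2 = 1)
    (hm : absMoment p a c = m)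
    (hmin : ∀ (a' : ℝ) (c' : Option (Fin n) → ℝ),
      m * (∑ i, c' i ^ 2) ^ (p / 2) ≤ absMoment p a' c')
    (hlt : ∀ t < 0, ∫ ω, |affineForm a c ω| ^ (p - 2) ∂(gaussExp n) <
      ∫ ω, |affineForm a c ω + t| ^ (p - 2) ∂(gaussExp n)) (j : Fin n) : c (some j) = 0 := by
  have hq : 0 < p - 2 := by linarith
  have hF' : PolyGrowth fun t : ℝ => t * |t| ^ (p - 2) := PolyGrowth.mul_abs_rpow hq.le
  have hF'' : PolyGrowth fun t : ℝ => |t| ^ (p - 2) := PolyGrowth.abs_rpow PolyGrowth.id hq.le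
  have hi : ∀ {K : (Option (Fin n) → ℝ) → ℝ}, PolyGrowth K → Integrable K (gaussExp n) :=
    fun hK => hK.integrable (hasAllMoments_gaussExp n)
  have hFX : PolyGrowth fun ω => affineForm a c ω * |affineForm a c ω| ^ (p - 2) :=
    hF'.comp (by fun_prop)
  have hFX' : PolyGrowth fun ω => |affineForm a c ω| ^ (p - 2) := hF''.comp (by fun_prop)
  have hcrit := integral_mul_abs_rpow_eq_zero_of_min hp hc hm hmin
  have hm_le := le_integral_abs_rpow_of_min hp hc hm hmin
  set h₀ := ∫ ω, |affineForm a c ω| ^ (p - 2) ∂(gaussExp n) with hh₀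
  set η : Fin n → ℝ := fun j => ∫ ω, ω (some j) * |affineForm a c ω| ^ (p - 2) ∂(gaussExp n) with hη
  have hη_le : ∀ j, c (some j) ≠ 0 → η j ≤ h₀ := fun j hj => by
    have h1 := integral_some_sub_one_mul a c j hF' (by fun_prop) (hasDerivAt_mul_abs_rpow_two_lt hp)
    have h2 := integral_apply_mul_eq_of_min hp hc hm hmin (some j)
    have h3 : ∫ ω, (ω (some j) - 1) * (affineForm a c ω * |affineForm a c ω| ^ (p - 2))
        ∂(gaussExp n) = m * c (some j) := by
      simp only [sub_mul, one_mul]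
      rw [integral_sub (hi (PolyGrowth.mul (by fun_prop) hFX)) (hi hFX), h2, hcrit, sub_zero]
    simp only [mul_left_comm _ (p - 1)] at h1
    rw [h3, integral_const_mul, mul_comm m] at h1
    have h4 : m = (p - 1) * η j := mul_left_cancel₀ hj h1
    rw [h4] at hm_le
    exact le_of_mul_le_mul_left hm_le (by linarith)
  have hnonneg : ∀ j, 0 ≤ c (some j) := fun j => by
    by_contra! hj
    have h1 := hη_le j hj.ne
    rw [hη] at h1
    simp only at h1
    rw [integral_some_mul a c j hF''] at h1
    have hv : PolyGrowth fun y =>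
        ∫ ω, |affineForm a c ω + c (some j) * y| ^ (p - 2) ∂(gaussExp n) :=
      PolyGrowth.integral_right (F := fun x : ℝ × (Option (Fin n) → ℝ) =>
        |affineForm a c x.2 + c (some j) * x.1| ^ (p - 2))
        (PolyGrowth.abs_rpow (by fun_prop) hq.le) (hasAllMoments_gaussExp n)
    have h2 := integral_pos_of_ae_pos ((hv.integrable hasAllMoments_expMeasure).sub
      (integrable_const h₀)) (by
        filter_upwards [ae_pos_expMeasure_one] with y hy
        exact sub_pos.2 (hlt _ (by nlinarith)))
    simp only [Pi.sub_apply] at h2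
    rw [integral_sub (hv.integrable hasAllMoments_expMeasure) (integrable_const h₀)] at h2
    simp at h2
    linarith
  by_contra hj
  have hpos : ∃ j, 0 < c (some j) := ⟨j, (hnonneg j).lt_of_ne' hj⟩
  have hmean : a + ∑ j, c (some j) < 0 := by
    by_contra! hmean
    have h1 := integral_mul_abs_rpow_affineForm_pos hnonneg hpos hq
    have h2 : ∫ ω, affineForm (-∑ j, c (some j)) c ω *
        |affineForm (-∑ j, c (some j)) c ω| ^ (p - 2) ∂(gaussExp n) ≤
        ∫ ω, affineForm a c ω * |affineForm a c ω| ^ (p - 2) ∂(gaussExp n) := by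
      refine integral_mono (hi (hF'.comp (by fun_prop))) (hi hFX) fun ω => ?_
      refine (strictMono_mul_abs_rpow hq.le).monotone ?_
      simp only [affineForm]
      linarith
    linarith
  have hh₀pos : 0 < h₀ := by
    refine (integral_nonneg fun ω => by positivity).lt_of_ne fun h => ?_
    have h1 := (integral_eq_zero_iff_of_nonneg (fun ω => by positivity) (hi hFX')).1 h.symm
    have h2 : ∫ ω, affineForm a c ω ∂(gaussExp n) = 0 := by
      refine integral_eq_zero_of_ae ?_
      filter_upwards [h1] with ω hω
      have := (Real.rpow_eq_zero (abs_nonneg (affineForm a c ω)) hq.ne').1 hω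
      exact abs_eq_zero.1 this
    rw [integral_affineForm] at h2
    linarith
  have hgauss : c none * ∫ ω, ω none * |affineForm a c ω| ^ (p - 2) ∂(gaussExp n) ≤ 0 := by
    have h1 := hasDerivAt_integral_affineForm_add a c hF''
    have h2 : HasDerivAt (fun τ => ∫ ω, |affineForm a c ω + c none * (c none * τ)| ^ (p - 2)
        ∂(gaussExp n)) (c none * ∫ ω, ω none * |affineForm a c ω| ^ (p - 2) ∂(gaussExp n)) 0 := by
      have h3 : HasDerivAt (fun τ => c none * τ) (c none) 0 := by
        simpa using (hasDerivAt_id (0 : ℝ)).const_mul (c none)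
      rw [mul_comm (c none) (∫ ω, _ ∂_)]
      refine HasDerivAt.comp (0 : ℝ) (h₂ := fun τ => ∫ ω, |affineForm a c ω + c none * τ| ^ (p - 2)
        ∂(gaussExp n)) ?_ h3
      simpa using h1
    refine le_of_tendsto (hasDerivWithinAt_iff_tendsto_slope' (s := Set.Iio 0) (by simp) |>.1
      h2.hasDerivWithinAt) ?_
    filter_upwards [self_mem_nhdsWithin] with τ hτ
    have hτ : τ < 0 := hτ
    rw [slope_def_field]
    refine div_nonpos_of_nonneg_of_nonpos (sub_nonneg.2 ?_) (by linarith)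
    simp only [mul_zero, add_zero]
    rcases eq_or_ne (c none) 0 with h | h
    · simp [h]
    · refine (hlt _ ?_).le
      have : 0 < c none * c none := mul_self_pos.2 h
      nlinarith
  have hsum : ∑ j, c (some j) * ∫ ω, (ω (some j) - 1) * |affineForm a c ω| ^ (p - 2)
      ∂(gaussExp n) ≤ 0 := by
    refine Finset.sum_nonpos fun j _ => ?_
    rcases (hnonneg j).eq_or_lt with h | h
    · rw [← h, zero_mul]
    · refine mul_nonpos_of_nonneg_of_nonpos h.le ?_
      simp only [sub_mul, one_mul]
      rw [integral_sub (hi (PolyGrowth.mul (by fun_prop) hFX')) (hi hFX')]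
      linarith [hη_le j h.ne']
  rw [integral_affineForm_mul a c hF''] at hcrit
  have := mul_neg_of_neg_of_pos hmean hh₀pos
  linarith

end Critical

/-- A drift only increases the moments of a symmetric variable. -/
lemma integral_abs_rpow_gaussianReal_le (hp : 1 ≤ p) (a : ℝ) {s : ℝ} (hs : s ^ 2 = 1) :
    ∫ y, |y| ^ p ∂(gaussianReal 0 1) ≤ ∫ y, |a + s * y| ^ p ∂(gaussianReal 0 1) := by
  have hi : ∀ {K : ℝ → ℝ}, PolyGrowth K → Integrable (fun y => |K y| ^ p) (gaussianReal 0 1) :=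
    fun hK => (PolyGrowth.abs_rpow hK (by linarith)).integrable hasAllMoments_gaussianReal
  have hsymm : ∫ y, |-a + s * y| ^ p ∂(gaussianReal 0 1) =
      ∫ y, |a + s * y| ^ p ∂(gaussianReal 0 1) := by
    have hmap : (gaussianReal 0 1).map (fun y => -y) = gaussianReal 0 1 := by
      simpa using gaussianReal_map_neg (μ := 0) (v := 1)
    conv_lhs => rw [← hmap]
    have hc : Continuous fun y : ℝ => |-a + s * y| ^ p :=
      (PolyGrowth.abs_rpow (by fun_prop) (by linarith)).continuous
    rw [integral_map (by fun_prop) hc.aestronglyMeasurable]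
    congr 1; ext y
    rw [← abs_neg]; congr 2; ring
  have h : ∫ y, |y| ^ p ∂(gaussianReal 0 1) ≤ ∫ y, ((1 / 2) * |a + s * y| ^ p +
      (1 / 2) * |-a + s * y| ^ p) ∂(gaussianReal 0 1) := by
    refine integral_mono (hi (K := fun y => y) (by fun_prop)) (((hi (by fun_prop)).const_mul _).add
      ((hi (by fun_prop)).const_mul _)) fun y => ?_
    have h1 := (convexOn_rpow hp).2 (abs_nonneg (a + s * y)) (abs_nonneg (-a + s * y))
      (by norm_num : (0 : ℝ) ≤ 1 / 2) (by norm_num : (0 : ℝ) ≤ 1 / 2) (by norm_num)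
    refine le_trans ?_ h1
    refine Real.rpow_le_rpow (abs_nonneg _) ?_ (by linarith)
    have hs1 : |s| = 1 := by
      rw [← sq_eq_sq₀ (abs_nonneg s) zero_le_one, sq_abs, hs, one_pow]
    have h2 : 2 * |y| = |(a + s * y) + (-a + s * y)| := by
      rw [show (a + s * y) + (-a + s * y) = 2 * (s * y) by ring, abs_mul, abs_mul, hs1]; simp
    have h3 := abs_add_le (a + s * y) (-a + s * y)
    simp only [smul_eq_mul]
    linarith
  rw [integral_add ((hi (by fun_prop)).const_mul _) ((hi (by fun_prop)).const_mul _),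
    integral_const_mul, integral_const_mul, hsymm] at h
  linarith

/-- The sharp moment inequality, for combinations with a drift and a Gaussian component. -/
theorem integral_gaussianReal_mul_le_absMoment (hp : 2 < p) (a : ℝ) (c : Option (Fin n) → ℝ) :
    (∫ y, |y| ^ p ∂(gaussianReal 0 1)) * (∑ i, c i ^ 2) ^ (p / 2) ≤ absMoment p a c := by
  obtain ⟨a₀, c₀, hc₀, hmin₀⟩ := exists_absMoment_le n (by linarith : 1 ≤ p)
  have hmin := mul_rpow_le_absMoment (m := absMoment p a₀ c₀) (by linarith : 1 ≤ p) hmin₀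
  refine le_trans (mul_le_mul_of_nonneg_right ?_ (by positivity)) (hmin a c)
  have hzero : ∀ j, c₀ (some j) = 0 := by
    rcases integral_abs_rpow_affineForm_lt (q := p - 2) (by linarith) a₀ c₀ with h | h
    · exact coeff_some_eq_zero_of_min hp hc₀ rfl hmin h
    · have := coeff_some_eq_zero_of_min (a := -a₀) (c := fun i => -c₀ i) hp (by simpa using hc₀)
        (absMoment_neg a₀ c₀) hmin fun t ht => by
          have e : ∀ ω, affineForm (-a₀) (fun i => -c₀ i) ω = -affineForm a₀ c₀ ω := fun ω => by
            simpa using affineForm_smul (-1) a₀ c₀ ω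
          have h1 := h (-t) (by linarith)
          have e2 : ∀ ω, |(-affineForm a₀ c₀ ω) + t| = |affineForm a₀ c₀ ω + -t| := fun ω => by
            rw [← abs_neg]; congr 1; ring
          simpa only [e, e2, abs_neg] using h1
      exact fun j => neg_eq_zero.1 (this j)
  have hs : c₀ none ^ 2 = 1 := by simpa [Fintype.sum_option, hzero] using hc₀
  refine (integral_abs_rpow_gaussianReal_le (by linarith : 1 ≤ p) a₀ hs).trans_eq ?_
  rw [absMoment, integral_affineForm_eq a₀ c₀ none (H := fun x => |x.1| ^ p)
    (PolyGrowth.abs_rpow (by fun_prop) (by linarith))]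
  simp [affineForm, Fintype.sum_option, hzero, gaussExpLaw]

/-! ### Sums of independent exponential variables on an arbitrary probability space -/

/-- The exponential part of `gaussExp n` has the law of any `n` independent standard exponential
variables. -/
lemma hasLaw_sum_mul {n : ℕ} {Ω : Type*} [MeasurableSpace Ω] {μ : Measure Ω}
    [IsProbabilityMeasure μ] {E : Fin n → Ω → ℝ} (hE : ∀ j, HasLaw (E j) (expMeasure 1) μ)
    (hind : iIndepFun E μ) (x : Fin n → ℝ) :
    HasLaw (fun ω => ∑ j, x j * E j ω)
      ((gaussExp n).map (affineForm 0 fun i => i.elim 0 x)) μ := by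
  have h1 : HasLaw (fun ω j => E j ω) (Measure.pi fun _ => expMeasure 1) μ :=
    hind.hasLaw_pi hE
  have h2 : HasLaw (fun (ω : Option (Fin n) → ℝ) j => ω (some j))
      (Measure.pi fun _ => expMeasure 1) (gaussExp n) := by
    have hi : iIndepFun (fun (i : Option (Fin n)) (ω : Option (Fin n) → ℝ) => ω i) (gaussExp n) :=
      iIndepFun_pi (X := fun _ => id) (fun i => aemeasurable_id)
    exact (hi.precomp (Option.some_injective _)).hasLaw_pi fun j =>
      (measurePreserving_eval (gaussExpLaw n) (some j)).hasLaw
  have hT : Measurable fun y : Fin n → ℝ => ∑ j, x j * y j := by fun_prop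
  refine ⟨hT.comp_aemeasurable h1.aemeasurable, ?_⟩
  have e1 : (fun ω => ∑ j, x j * E j ω) =
      (fun y : Fin n → ℝ => ∑ j, x j * y j) ∘ fun ω j => E j ω := rfl
  have e2 : affineForm 0 (fun i : Option (Fin n) => i.elim 0 x) =
      (fun y : Fin n → ℝ => ∑ j, x j * y j) ∘ fun ω j => ω (some j) := by
    ext ω
    simp [affineForm, Fintype.sum_option]
  rw [e1, e2, ← AEMeasurable.map_map_of_aemeasurable hT.aemeasurable h1.aemeasurable,
    ← AEMeasurable.map_map_of_aemeasurable hT.aemeasurable h2.aemeasurable, h1.map_eq, h2.map_eq]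

lemma ProbabilityTheory.HasLaw.memLp_of_hasAllMoments {Ω : Type*} [MeasurableSpace Ω]
    {μ : Measure Ω} {Y : Ω → ℝ} {κ : Measure ℝ} (hY : HasLaw Y κ μ) (hκ : HasAllMoments κ) {p : ℝ}
    (hp : 0 < p) : MemLp Y (ENNReal.ofReal p) μ := by
  rw [← integrable_norm_rpow_iff hY.aemeasurable.aestronglyMeasurable
    (by simpa using hp) ENNReal.ofReal_ne_top, ENNReal.toReal_ofReal hp.le]
  have hK : PolyGrowth fun y : ℝ => |y| ^ p := PolyGrowth.abs_rpow PolyGrowth.id hp.le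
  have := hK.integrable hκ
  rw [← hY.map_eq, integrable_map_measure hK.continuous.aestronglyMeasurable
    hY.aemeasurable] at this
  exact this

lemma ProbabilityTheory.HasLaw.lpNorm_eq {Ω : Type*} [MeasurableSpace Ω] {μ : Measure Ω}
    {Y : Ω → ℝ} {κ : Measure ℝ} (hY : HasLaw Y κ μ) {p : ℝ}
    (hp : 0 < p) : lpNorm Y (ENNReal.ofReal p) μ = (∫ y, |y| ^ p ∂κ) ^ p⁻¹ := by
  rw [lpNorm_eq_integral_norm_rpow_toReal (by simpa using hp) ENNReal.ofReal_ne_top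
    hY.aemeasurable.aestronglyMeasurable, ENNReal.toReal_ofReal hp.le]
  congr 1
  have hK : PolyGrowth fun y : ℝ => |y| ^ p := PolyGrowth.abs_rpow PolyGrowth.id hp.le
  exact hY.integral_comp hK.continuous.aestronglyMeasurable

section Transfer

variable {n : ℕ} {Ω : Type*} [MeasurableSpace Ω] {μ : Measure Ω} [IsProbabilityMeasure μ]

lemma hasAllMoments_map_affineForm (a : ℝ) (c : Option (Fin n) → ℝ) :
    HasAllMoments ((gaussExp n).map (affineForm a c)) := by
  have hX : PolyGrowth fun ω => affineForm a c ω := by fun_prop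
  intro k
  rw [integrable_map_measure (by fun_prop) hX.continuous.measurable.aemeasurable]
  exact (by fun_prop : PolyGrowth fun ω => ‖affineForm a c ω‖ ^ k).integrable
    (hasAllMoments_gaussExp n)

lemma integral_map_affineForm (a : ℝ) (c : Option (Fin n) → ℝ) {K : ℝ → ℝ} (hK : PolyGrowth K) :
    ∫ y, K y ∂((gaussExp n).map (affineForm a c)) = ∫ ω, K (affineForm a c ω) ∂(gaussExp n) := by
  have hX : PolyGrowth fun ω => affineForm a c ω := by fun_prop
  exact integral_map hX.continuous.measurable.aemeasurable hK.continuous.aestronglyMeasurable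

lemma integral_affineForm_sq (a : ℝ) (c : Option (Fin n) → ℝ) :
    ∫ ω, affineForm a c ω ^ 2 ∂(gaussExp n) = (a + ∑ j, c (some j)) ^ 2 + ∑ i, c i ^ 2 := by
  have hd : ∀ t : ℝ, HasDerivAt (fun t => t) 1 t := fun t => hasDerivAt_id' t
  simp only [sq (affineForm _ _ _)]
  rw [integral_affineForm_mul a c (F := fun t => t) (by fun_prop), integral_affineForm,
    integral_none_mul a c (by fun_prop) (by fun_prop) hd, Fintype.sum_option]
  simp only [fun j => integral_some_sub_one_mul a c j (F := fun t => t) (by fun_prop)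
    (by fun_prop) hd, mul_one, integral_apply_some]
  simp
  simp only [sq]
  ring

lemma variance_sum_mul {E : Fin n → Ω → ℝ} (hE : ∀ j, HasLaw (E j) (expMeasure 1) μ)
    (hind : iIndepFun E μ) (x : Fin n → ℝ) :
    Var[fun ω => ∑ j, x j * E j ω; μ] = ∑ j, x j ^ 2 := by
  have hL := hasLaw_sum_mul hE hind x
  have hmem := hL.memLp_of_hasAllMoments (hasAllMoments_map_affineForm _ _) two_pos
  rw [variance_eq_sub (by simpa using hmem)]
  have h1 : ∫ ω, (fun ω => ∑ j, x j * E j ω) ω ∂μ = ∑ j, x j := by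
    rw [hL.integral_eq, integral_map_affineForm 0 _ PolyGrowth.id, integral_affineForm]
    simp
  have h2 : ∫ ω, ((fun ω => ∑ j, x j * E j ω) ^ 2) ω ∂μ = (∑ j, x j) ^ 2 + ∑ j, x j ^ 2 := by
    have := hL.integral_comp (f := fun y : ℝ => y ^ 2) (by fun_prop)
    simp only [Pi.pow_apply]
    simp only [Function.comp_def] at this
    rw [this, integral_map_affineForm 0 _ (by fun_prop), integral_affineForm_sq]
    simp [Fintype.sum_option]
  rw [h1, h2]
  ring

lemma integral_sq_gaussianReal : ∫ y, y ^ 2 ∂(gaussianReal 0 1) = 1 := by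
  have := integral_mul_gaussianReal (F := fun y => y) (F' := fun _ => 1) (by fun_prop)
    (by fun_prop) fun t => hasDerivAt_id' t
  simpa [sq] using this

/-- The moment inequality, including the elementary case `p = 2`. -/
lemma integral_gaussianReal_mul_le_absMoment_of_two_le {p : ℝ} (hp : 2 ≤ p) (a : ℝ)
    (c : Option (Fin n) → ℝ) :
    (∫ y, |y| ^ p ∂(gaussianReal 0 1)) * (∑ i, c i ^ 2) ^ (p / 2) ≤ absMoment p a c := by
  rcases hp.eq_or_lt with rfl | hp
  · simp only [absMoment, Real.rpow_two, sq_abs, integral_sq_gaussianReal, integral_affineForm_sq]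
    rw [div_self two_ne_zero, Real.rpow_one, one_mul]
    linarith [sq_nonneg (a + ∑ j, c (some j))]
  · exact integral_gaussianReal_mul_le_absMoment hp a c

lemma lpNorm_mul_sqrt_variance_le {p : ℝ} (hp : 2 ≤ p) {E : Fin n → Ω → ℝ}
    (hE : ∀ j, HasLaw (E j) (expMeasure 1) μ) (hind : iIndepFun E μ) (x : Fin n → ℝ)
    {Ω₀ : Type*} [MeasurableSpace Ω₀] {ν : Measure Ω₀} [IsProbabilityMeasure ν]
    {G : Ω₀ → ℝ} (hG : HasLaw G (gaussianReal 0 1) ν) :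
    lpNorm G (ENNReal.ofReal p) ν * √(Var[fun ω => ∑ j, x j * E j ω; μ]) ≤
      lpNorm (fun ω => ∑ j, x j * E j ω) (ENNReal.ofReal p) μ := by
  have hp0 : 0 < p := by linarith
  have hb : 0 ≤ ∑ j, x j ^ 2 := Finset.sum_nonneg fun j _ => sq_nonneg _
  have hM : 0 ≤ ∫ y, |y| ^ p ∂(gaussianReal 0 1) := integral_nonneg fun y => by positivity
  have h := integral_gaussianReal_mul_le_absMoment_of_two_le hp 0
    (fun i : Option (Fin n) => i.elim 0 x)
  have h2 : ∑ i : Option (Fin n), (i.elim 0 x : ℝ) ^ 2 = ∑ j, x j ^ 2 := by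
    simp [Fintype.sum_option]
  rw [h2] at h
  rw [hG.lpNorm_eq hp0, (hasLaw_sum_mul hE hind x).lpNorm_eq hp0, variance_sum_mul hE hind,
    integral_map_affineForm 0 _ (PolyGrowth.abs_rpow PolyGrowth.id hp0.le)]
  have h3 := Real.rpow_le_rpow (by positivity) h (inv_nonneg.2 hp0.le)
  rw [Real.mul_rpow hM (by positivity), ← Real.rpow_mul hb] at h3
  have h4 : p / 2 * p⁻¹ = 1 / 2 := by field_simp
  rw [h4, ← Real.sqrt_eq_rpow] at h3
  exact h3

end Transfer

/-! ### Balanced signs as a Gaussian mixture -/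

section Mixture

lemma integral_cexp_neg_mul_expMeasure {v : ℝ} (hv : 0 ≤ v) :
    ∫ y, Complex.exp (-(v * y : ℝ)) ∂(expMeasure 1) = ((1 + v)⁻¹ : ℝ) := by
  rw [integral_expMeasure_one]
  have e : ∀ y : ℝ, Real.exp (-y) • Complex.exp (-(v * y : ℝ)) =
      Complex.exp ((-(1 + v) : ℝ) * y) := fun y => by
    rw [Complex.real_smul, Complex.ofReal_exp, ← Complex.exp_add]
    congr 1; push_cast; ring
  simp only [e]
  rw [integral_exp_mul_complex_Ioi (by simp; linarith)]
  simp only [Complex.ofReal_zero, mul_zero, Complex.exp_zero]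
  push_cast
  rw [neg_div_neg_eq, one_div]

lemma measurable_affineForm {n : ℕ} (a : ℝ) (c : Option (Fin n) → ℝ) :
    Measurable (affineForm a c) :=
  (by fun_prop : PolyGrowth fun ω => affineForm a c ω).continuous.measurable

/-- The joint law of `m` independent standard exponential variables and a standard Gaussian. -/
noncomputable def expPiGauss (m : ℕ) : Measure ((Fin m → ℝ) × ℝ) :=
  (Measure.pi fun _ => expMeasure 1).prod (gaussianReal 0 1)

instance (m : ℕ) : IsProbabilityMeasure (expPiGauss m) := by
  unfold expPiGauss; infer_instance

lemma ae_sum_div_nonneg (m : ℕ) :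
    ∀ᵐ y ∂(Measure.pi fun _ : Fin m => expMeasure 1), 0 ≤ (∑ j, y j) / (m : ℝ) := by
  have h : ∀ᵐ y ∂(Measure.pi fun _ : Fin m => expMeasure 1), ∀ j, 0 < y j :=
    ae_all_iff.2 fun j => (measurePreserving_eval (fun _ : Fin m => expMeasure 1)
      j).quasiMeasurePreserving.ae ae_pos_expMeasure_one
  filter_upwards [h] with y hy
  exact div_nonneg (Finset.sum_nonneg fun j _ => (hy j).le) (Nat.cast_nonneg m)

lemma charFun_mixture (m : ℕ) (t : ℝ) :
    charFun ((expPiGauss m).map fun x => √((∑ j, x.1 j) / (m : ℝ)) * x.2) t =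
      (((1 + t ^ 2 / (2 * m))⁻¹ ^ m : ℝ) : ℂ) := by
  rw [charFun_apply_real, integral_map (by fun_prop) (by fun_prop), expPiGauss, integral_prod]
  · have h1 : ∀ᵐ y ∂(Measure.pi fun _ : Fin m => expMeasure 1),
        ∫ g, Complex.exp (t * (√((∑ j, y j) / (m : ℝ)) * g : ℝ) * Complex.I) ∂(gaussianReal 0 1) =
        ∏ j, Complex.exp (-(t ^ 2 / (2 * m) * y j : ℝ)) := by
      filter_upwards [ae_sum_div_nonneg m] with y hy
      have h2 := charFun_gaussianReal (μ := 0) (v := 1) (t * √((∑ j, y j) / (m : ℝ)))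
      rw [charFun_apply_real] at h2
      have e : ∀ g : ℝ, (t : ℂ) * (√((∑ j, y j) / (m : ℝ)) * g : ℝ) * Complex.I =
          (t * √((∑ j, y j) / (m : ℝ)) : ℝ) * g * Complex.I := fun g => by
        push_cast; ring
      simp only [e, h2, ← Complex.exp_sum]
      congr 1
      rw [Complex.ofReal_mul, mul_pow, ← Complex.ofReal_pow (√_), Real.sq_sqrt hy,
        Finset.sum_neg_distrib]
      push_cast
      rw [← Finset.mul_sum]
      simp
      ring
    rw [integral_congr_ae h1, integral_fintype_prod_eq_prod
      (f := fun (_ : Fin m) y => Complex.exp (-(t ^ 2 / (2 * m) * y : ℝ)))]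
    simp only [integral_cexp_neg_mul_expMeasure (by positivity : 0 ≤ t ^ 2 / (2 * (m : ℝ)))]
    simp
  · refine Integrable.of_bound (C := 1) (by fun_prop) (Eventually.of_forall fun x => ?_)
    rw [← Complex.ofReal_mul, Complex.norm_exp_ofReal_mul_I]

/-- The coefficients `(1, -1, …, 1, -1) / √(2m)`. -/
noncomputable def balancedCoeff (m : ℕ) (j : Fin (2 * m)) : ℝ :=
  (-1) ^ (j : ℕ) / √(2 * m : ℝ)

lemma sum_balancedCoeff_sq {m : ℕ} (hm : 1 ≤ m) : ∑ j, balancedCoeff m j ^ 2 = 1 := by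
  have hm' : (0 : ℝ) < 2 * m := by positivity
  have e : ∀ j, balancedCoeff m j ^ 2 = (2 * (m : ℝ))⁻¹ := fun j => by
    rw [balancedCoeff, div_pow, Real.sq_sqrt hm'.le, ← pow_mul, mul_comm _ 2, pow_mul (-1 : ℝ)]
    simp
  simp only [e]
  simp
  field_simp

lemma charFun_balanced (m : ℕ) (t : ℝ) :
    charFun ((gaussExp (2 * m)).map (affineForm 0 fun i => i.elim 0 (balancedCoeff m))) t =
      (((1 + t ^ 2 / (2 * m))⁻¹ ^ m : ℝ) : ℂ) := by
  rw [charFun_apply_real, integral_map (measurable_affineForm _ _).aemeasurable (by fun_prop)]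
  simp only [← Complex.ofReal_mul, integral_cexp_affineForm]
  have h1 : ∑ j, Real.arctan (t * balancedCoeff m j) = 0 := by
    have e : ∀ j : Fin (2 * m), Real.arctan (t * balancedCoeff m j) =
        (-1) ^ (j : ℕ) * Real.arctan (t / √(2 * m : ℝ)) := fun j => by
      rw [balancedCoeff]
      rcases neg_one_pow_eq_or ℝ (j : ℕ) with h | h <;> rw [h]
      · rw [one_mul]; congr 1; ring
      · rw [neg_one_mul, ← Real.arctan_neg]; congr 1; ring
    simp only [e, ← Finset.sum_mul]
    rw [Fin.sum_univ_eq_sum_range (fun j => (-1 : ℝ) ^ j) (2 * m), neg_one_geom_sum]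
    simp
  have h2 : ∀ j, (t * balancedCoeff m j) ^ 2 = t ^ 2 / (2 * m) := fun j => by
    rw [balancedCoeff, mul_pow, div_pow, Real.sq_sqrt (by positivity), ← pow_mul, mul_comm _ 2,
      pow_mul (-1 : ℝ)]
    simp
    ring
  have h3 : charModulus (fun i : Option (Fin (2 * m)) => i.elim 0 (balancedCoeff m)) t =
      (1 + t ^ 2 / (2 * m))⁻¹ ^ m := by
    simp only [charModulus, Option.elim, h2, Finset.prod_const, Finset.card_univ, Fintype.card_fin]
    rw [pow_mul, inv_pow, Real.sq_sqrt (by positivity)]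
    simp
  simp only [Option.elim] at h3 ⊢
  rw [h3, h1]
  simp

/-- The difference of two independent exponential variables is distributed as `√(2 * E) * G`, so
the balanced combination is Gaussian with the random variance `(E 1 + ⋯ + E m) / m`. -/
lemma map_balanced_eq_mixture (m : ℕ) :
    (gaussExp (2 * m)).map (affineForm 0 fun i => i.elim 0 (balancedCoeff m)) =
      (expPiGauss m).map fun x => √((∑ j, x.1 j) / (m : ℝ)) * x.2 := by
  have := Measure.isProbabilityMeasure_map (μ := gaussExp (2 * m))
    (measurable_affineForm 0 fun i : Option (Fin (2 * m)) =>
      i.elim 0 (balancedCoeff m)).aemeasurable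
  have := Measure.isProbabilityMeasure_map (μ := expPiGauss m)
    (f := fun x => √((∑ j, x.1 j) / (m : ℝ)) * x.2) (by fun_prop)
  refine Measure.ext_of_charFun ?_
  ext t
  rw [charFun_balanced, charFun_mixture]

lemma integral_abs_rpow_balanced (m : ℕ) {p : ℝ} (hp : 0 < p) :
    ∫ y, |y| ^ p ∂((gaussExp (2 * m)).map (affineForm 0 fun i => i.elim 0 (balancedCoeff m))) =
      (∫ y, |(∑ j, y j) / (m : ℝ)| ^ (p / 2) ∂(Measure.pi fun _ : Fin m => expMeasure 1)) *
        ∫ g, |g| ^ p ∂(gaussianReal 0 1) := by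
  have hc : Continuous fun y : ℝ => |y| ^ p :=
    (PolyGrowth.abs_rpow PolyGrowth.id hp.le).continuous
  rw [map_balanced_eq_mixture, integral_map (by fun_prop) hc.aestronglyMeasurable, expPiGauss]
  simp only [abs_mul, Real.mul_rpow (abs_nonneg _) (abs_nonneg _)]
  rw [integral_prod_mul (fun y : Fin m → ℝ => |√((∑ j, y j) / (m : ℝ))| ^ p) (fun g => |g| ^ p)]
  congr 1
  refine integral_congr_ae ?_
  filter_upwards [ae_sum_div_nonneg m] with y hy
  rw [abs_of_nonneg (Real.sqrt_nonneg _), abs_of_nonneg hy, Real.sqrt_eq_rpow, ← Real.rpow_mul hy]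
  congr 1; ring

end Mixture

section Sharpness

lemma sum_range_balanced {Ω : Type*} (E : ℕ → Ω → ℝ) (m : ℕ) (ω : Ω) :
    ∑ j ∈ Finset.range (2 * m), ((-1) ^ j / √(2 * m : ℝ)) * E j ω =
      ∑ j : Fin (2 * m), balancedCoeff m j * E j ω := by
  rw [Finset.sum_range]; rfl

variable {Ω : Type*} [MeasurableSpace Ω] {μ : Measure Ω} [IsProbabilityMeasure μ]
  {E : ℕ → Ω → ℝ}

/-- The `p`-norm of the balanced combination of `2 * m` variables, through the `p / 2`-norm of
the mean of `m` of them. -/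
lemma lpNorm_balanced (hE : ∀ j, HasLaw (E j) (expMeasure 1) μ) (hind : iIndepFun E μ) {p : ℝ}
    (hp : 0 < p) {Ω₀ : Type*} [MeasurableSpace Ω₀] {ν : Measure Ω₀} {G : Ω₀ → ℝ}
    (hG : HasLaw G (gaussianReal 0 1) ν) (m : ℕ) :
    lpNorm (fun ω => ∑ j ∈ Finset.range (2 * m), ((-1) ^ j / √(2 * m : ℝ)) * E j ω)
      (ENNReal.ofReal p) μ = lpNorm G (ENNReal.ofReal p) ν *
        √(lpNorm (fun ω => (m : ℝ)⁻¹ • ∑ j ∈ Finset.range m, E j ω)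
          (ENNReal.ofReal (p / 2)) μ) := by
  have h1 : HasLaw (fun ω (j : Fin m) => E j ω) (Measure.pi fun _ => expMeasure 1) μ :=
    (hind.precomp Fin.val_injective).hasLaw_pi fun j => hE j
  have hae : AEMeasurable (fun ω => (m : ℝ)⁻¹ • ∑ j ∈ Finset.range m, E j ω) μ := by
    have h : AEMeasurable (fun ω => ∑ j ∈ Finset.range m, E j ω) μ :=
      Finset.aemeasurable_fun_sum _ fun j _ => (hE j).aemeasurable
    exact h.const_smul (m : ℝ)⁻¹
  have hc : Continuous fun y : Fin m → ℝ => |(∑ j, y j) / (m : ℝ)| ^ (p / 2) :=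
    (PolyGrowth.abs_rpow (by simp only [div_eq_mul_inv]; fun_prop) (by positivity)).continuous
  have h2 : ∫ ω, ‖(m : ℝ)⁻¹ • ∑ j ∈ Finset.range m, E j ω‖ ^ (p / 2) ∂μ =
      ∫ y, |(∑ j, y j) / (m : ℝ)| ^ (p / 2) ∂(Measure.pi fun _ : Fin m => expMeasure 1) := by
    rw [← h1.integral_comp hc.aestronglyMeasurable]
    congr 1; ext ω
    simp only [Function.comp, Real.norm_eq_abs, smul_eq_mul, Finset.sum_range, div_eq_inv_mul]
  have hA : 0 ≤ ∫ y, |(∑ j, y j) / (m : ℝ)| ^ (p / 2)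
      ∂(Measure.pi fun _ : Fin m => expMeasure 1) := integral_nonneg fun y => by positivity
  simp only [sum_range_balanced]
  rw [(hasLaw_sum_mul (fun j : Fin (2 * m) => hE j) (hind.precomp Fin.val_injective)
    (balancedCoeff m)).lpNorm_eq hp, integral_abs_rpow_balanced m hp, hG.lpNorm_eq hp,
    lpNorm_eq_integral_norm_rpow_toReal (by simpa using hp) ENNReal.ofReal_ne_top
    hae.aestronglyMeasurable, ENNReal.toReal_ofReal (by positivity), h2,
    Real.mul_rpow hA (integral_nonneg fun y => by positivity), mul_comm, Real.sqrt_eq_rpow,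
    ← Real.rpow_mul hA]
  congr 2
  field_simp

/-- By the law of large numbers in `L ^ (p / 2)`, the random variance of the mixture tends
to `1`. -/
lemma tendsto_lpNorm_balanced (hE : ∀ j, HasLaw (E j) (expMeasure 1) μ) (hind : iIndepFun E μ)
    {p : ℝ} (hp : 2 ≤ p) {Ω₀ : Type*} [MeasurableSpace Ω₀] {ν : Measure Ω₀}
    [IsProbabilityMeasure ν] {G : Ω₀ → ℝ} (hG : HasLaw G (gaussianReal 0 1) ν) :
    Tendsto (fun m : ℕ =>
      lpNorm (fun ω => ∑ j ∈ Finset.range (2 * m), ((-1) ^ j / √(2 * m : ℝ)) * E j ω)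
        (ENNReal.ofReal p) μ) atTop (𝓝 (lpNorm G (ENNReal.ofReal p) ν)) := by
  have hp0 : 0 < p := by linarith
  have hone : (1 : ENNReal) ≤ ENNReal.ofReal (p / 2) := by
    rw [ENNReal.one_le_ofReal]; linarith
  have hmean : ∫ ω, E 0 ω ∂μ = 1 := by
    rw [(hE 0).integral_eq]
    simpa using integral_mul_expMeasure (φ := fun _ => 1) (by fun_prop)
  have hmem : ∀ j, MemLp (E j) (ENNReal.ofReal (p / 2)) μ := fun j =>
    (hE j).memLp_of_hasAllMoments hasAllMoments_expMeasure (by positivity)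
  have hlln := strong_law_Lp hone ENNReal.ofReal_ne_top E (hmem 0)
    (fun i j hij => hind.indepFun hij) (fun i => (hE i).identDistrib (hE 0))
  simp only [hmean] at hlln
  set A : ℕ → Ω → ℝ := fun m ω => (m : ℝ)⁻¹ • ∑ j ∈ Finset.range m, E j ω with hA
  have hAmem : ∀ m, MemLp (A m) (ENNReal.ofReal (p / 2)) μ := fun m => by
    have h : MemLp (fun ω => ∑ j ∈ Finset.range m, E j ω) (ENNReal.ofReal (p / 2)) μ :=
      memLp_finsetSum _ fun j _ => hmem j
    exact h.const_smul (m : ℝ)⁻¹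
  have hlln' : Tendsto (fun m => lpNorm (A m - fun _ => (1 : ℝ)) (ENNReal.ofReal (p / 2)) μ) atTop
      (𝓝 0) := by
    have h := (ENNReal.tendsto_toReal ENNReal.zero_ne_top).comp hlln
    refine h.congr fun m => ?_
    exact toReal_eLpNorm ((hAmem m).sub (memLp_const 1)).aestronglyMeasurable
  have hle : ∀ m, lpNorm (A m) (ENNReal.ofReal (p / 2)) μ ≤
      1 + lpNorm (A m - fun _ => (1 : ℝ)) (ENNReal.ofReal (p / 2)) μ := fun m => by
    have h := lpNorm_le_lpNorm_add_lpNorm_sub' (f := A m) (memLp_const (μ := μ) (1 : ℝ)) hone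
    have h1 : lpNorm (fun _ : Ω => (1 : ℝ)) (ENNReal.ofReal (p / 2)) μ = 1 := by
      rw [lpNorm_const (by simpa using hp0) (IsProbabilityMeasure.ne_zero μ)]
      simp
    rwa [h1] at h
  have hup : Tendsto (fun m => lpNorm G (ENNReal.ofReal p) ν *
      √(1 + lpNorm (A m - fun _ => (1 : ℝ)) (ENNReal.ofReal (p / 2)) μ)) atTop
      (𝓝 (lpNorm G (ENNReal.ofReal p) ν)) := by
    have := ((Real.continuous_sqrt.tendsto (1 + 0)).comp (hlln'.const_add 1)).const_mul
      (lpNorm G (ENNReal.ofReal p) ν)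
    simpa using this
  refine tendsto_of_tendsto_of_tendsto_of_le_of_le' tendsto_const_nhds hup ?_ ?_
  · -- the lower bound is the moment inequality itself
    filter_upwards [eventually_ge_atTop 1] with m hm
    have h := lpNorm_mul_sqrt_variance_le hp (fun j : Fin (2 * m) => hE j)
      (hind.precomp Fin.val_injective) (balancedCoeff m) hG
    rw [variance_sum_mul (fun j : Fin (2 * m) => hE j) (hind.precomp Fin.val_injective),
      sum_balancedCoeff_sq hm, Real.sqrt_one, mul_one] at h
    simpa only [sum_range_balanced] using h
  · refine Eventually.of_forall fun m => ?_
    rw [lpNorm_balanced hE hind hp0 hG]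
    exact mul_le_mul_of_nonneg_left (Real.sqrt_le_sqrt (hle m)) lpNorm_nonneg

end Sharpness

/-! ### The sharp moment inequality -/

/-- `E` is a family of independent standard exponential random variables, `G` a standard Gaussian.
First part: the inequality (with finiteness of the `p`-th moment of `X`, so that all norms and the
variance are genuine). Second part: asymptotic sharpness, along the balanced vectors
`(1, -1, 1, -1, …, 1, -1) / √(2m)`, for which the variance is `1`. -/
theorem theorem1 (p : ℝ) (hp : 2 ≤ p)
    {Ω₀ : Type*} [MeasurableSpace Ω₀] (ν : Measure Ω₀) [IsProbabilityMeasure ν]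
    (G : Ω₀ → ℝ) (hG : HasLaw G (gaussianReal 0 1) ν) :
    (∀ (n : ℕ), 1 ≤ n →
      ∀ {Ω : Type*} [MeasurableSpace Ω] (μ : Measure Ω) [IsProbabilityMeasure μ]
        (E : Fin n → Ω → ℝ), (∀ j, HasLaw (E j) (expMeasure 1) μ) → iIndepFun E μ →
      ∀ (x : Fin n → ℝ),
        MemLp (fun ω => ∑ j, x j * E j ω) (ENNReal.ofReal p) μ ∧
        lpNorm G (ENNReal.ofReal p) ν * √(Var[fun ω => ∑ j, x j * E j ω; μ]) ≤
          lpNorm (fun ω => ∑ j, x j * E j ω) (ENNReal.ofReal p) μ) ∧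
    (∀ {Ω : Type*} [MeasurableSpace Ω] (μ : Measure Ω) [IsProbabilityMeasure μ]
        (E : ℕ → Ω → ℝ), (∀ j, HasLaw (E j) (expMeasure 1) μ) → iIndepFun E μ →
      (∀ m : ℕ, 1 ≤ m →
        Var[fun ω => ∑ j ∈ Finset.range (2 * m), ((-1) ^ j / √(2 * m : ℝ)) * E j ω; μ] = 1) ∧
      Tendsto (fun m : ℕ =>
          lpNorm (fun ω => ∑ j ∈ Finset.range (2 * m), ((-1) ^ j / √(2 * m : ℝ)) * E j ω)
            (ENNReal.ofReal p) μ)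
        atTop (𝓝 (lpNorm G (ENNReal.ofReal p) ν))) := by
  refine ⟨fun n _ Ω _ μ _ E hE hind x => ⟨?_, lpNorm_mul_sqrt_variance_le hp hE hind x hG⟩,
    fun {Ω} _ μ _ E hE hind => ⟨fun m hm => ?_, tendsto_lpNorm_balanced hE hind hp hG⟩⟩
  · exact (hasLaw_sum_mul hE hind x).memLp_of_hasAllMoments (hasAllMoments_map_affineForm _ _)
      (by linarith)
  · simp only [sum_range_balanced]
    rw [variance_sum_mul (fun j : Fin (2 * m) => hE j) (hind.precomp Fin.val_injective),
      sum_balancedCoeff_sq hm]
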